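/- Let $(M,g_M)$ and $(B,g_B)$ be (finite-dimensional, smooth) semi-Riemannian manifolds and let $\pi:(M,g_M)\to(B,g_B)$ be a semi-Riemannian submersion, i.e. a smooth surjective submersion whose fibers are nondegenerate and whose differential preserves scalar products of horizontal vectors (vectors orthogonal to $\ker d\pi$). For $\varepsilon\in\{1,-1\}$ endow $M\times\mathbb R$ and $B\times\mathbb R$ with the metrics $g_M+\varepsilon\,dt^2$ and $g_B+\varepsilon\,dt^2$. For a submersion $P$ and a vector field $\xi$ normal to its fibers, the mean curvature of the fibers of $P$ in the direction of $\xi$ is $$H_{\mathrm{fib}}^{\xi}=\sum_i\varepsilon_i\,\langle\nabla_{e_i}\xi,e_i\rangle ,$$ where $\nabla$ is the Levi-Civita connection of the total space and $(e_i)$ is an orthonormal basis, $\langle e_i,e_i\rangle=\varepsilon_i=\pm1$, of the tangent space of the fiber. Assume that the fibers of $\pi$ have constant mean curvature, in the sense that for every basic vector field $X$ on $M$ (horizontal and $\pi$-related to a vector field on $B$) the function $H_{\mathrm{fib}}^{X}$ is constant along each fiber of $\pi$. Let $u\in C^2(B)$, let $F:B\to B\times\mathbb R$, $F(p)=(p,u(p))$,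 and $\widetilde F:M\to M\times\mathbb R$, $\widetilde F(x)=(x,u(\pi(x)))$, and assume that they have unit upward normals $\nu_F$ and $\nu_{\widetilde F}$ (normal to the graph, $\langle\nu,\nu\rangle=\pm1$, with positive $\partial_t$-component). Put $\varepsilon'=\langle\nu_F,\nu_F\rangle=\pm1$. For a nondegenerate immersion, $\vec H=\mathrm{tr}\,II$ denotes the mean curvature vector (the trace of the second fundamental form with respect to the induced metric) and $\partial_t^\perp$ the normal component of $\partial_t$; a graph is a graphical translating soliton if it is nondegenerate and $\vec H=\partial_t^\perp$. Extend $\nu_{\widetilde F}$ to $M\times\mathbb R$ by translations in $t$. Then the mean curvature $H_{\mathrm{fib}}^{\nu_{\widetilde F}}$ of the fibers of $\pi\times 1:M\times\mathbb R\to B\times\mathbb R$ in the direction of $\nu_{\widetilde F}$ descends to a function on $B$ (denoted in the same way), and $\widetilde F$ is a graphical translating soliton if and only if, on $B$, $$\vec H_F=\partial_t^{\perp}+\varepsilon'\,H_{\mathrm{fib}}^{\nu_{\widetilde F}}\,\nu_F .$$ -/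

import Mathlib

open scoped Manifold ContDiff

noncomputable section

namespace TransSoliton

/-! ## Linear algebra -/

/-- The metric contraction `γ^{ij} b(e_i, e_j)` of `b` with respect to a (nondegenerate, possibly
indefinite) scalar product `γ` on a finite-dimensional space; `(γ^{ij})` is the inverse of the Gram
matrix `(γ(e_i, e_j))`. For bilinear `b` and nondegenerate `γ` the basis is immaterial, and the
value is `∑ ε_i b(e_i, e_i)` for any `γ`-orthonormal basis with `γ(e_i, e_i) = ε_i`. -/
def metricTrace {V W : Type*} [AddCommGroup V] [Module ℝ V] [FiniteDimensional ℝ V]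
    [AddCommGroup W] [Module ℝ W] (γ : LinearMap.BilinForm ℝ V) (b : V → V → W) : W :=
  ∑ i, ∑ j,
    (LinearMap.BilinForm.toMatrix (Module.finBasis ℝ V) γ)⁻¹ i j •
      b (Module.finBasis ℝ V i) (Module.finBasis ℝ V j)

/-- The vector `α^♯ = γ^{ij} α(e_i) e_j`, i.e. `γ(α^♯, w) = α(w)` when `γ` is nondegenerate and
`α` is linear. -/
def sharp {V : Type*} [AddCommGroup V] [Module ℝ V] [FiniteDimensional ℝ V]
    (γ : LinearMap.BilinForm ℝ V) (α : V → ℝ) : V :=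
  metricTrace γ (fun v w => α v • w)

section Manifold

variable {E : Type*} [NormedAddCommGroup E] [NormedSpace ℝ E] [FiniteDimensional ℝ E]
  {H : Type*} [TopologicalSpace H] (I : ModelWithCorners ℝ E H)
  (M : Type*) [TopologicalSpace M] [ChartedSpace H M]

instance tangentFiniteDimensional {M : Type*} [TopologicalSpace M] [ChartedSpace H M] (x : M) :
    FiniteDimensional ℝ (TangentSpace I x) :=
  inferInstanceAs (FiniteDimensional ℝ E)

/-- The tangent vector at `x` with coordinates `v` in the chart around `x`. -/
def ofCoord (I : ModelWithCorners ℝ E H) {M : Type*} [TopologicalSpace M] [ChartedSpace H M]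
    (x : M) (v : E) : TangentSpace I x := v

/-- A field of bilinear forms on the tangent spaces. -/
abbrev BilinField : Type _ := (x : M) → LinearMap.BilinForm ℝ (TangentSpace I x)

variable {I M}

/-- The component function `e ↦ g(v, w)` of `g` in the chart around `x`, where `v, w` are
vector fields with constant coordinates, as a function on the model space. -/
def metricCoeff (g : BilinField I M) (x : M) (v w : E) (e : E) : ℝ :=
  g ((extChartAt I x).symm e)
    (mfderiv 𝓘(ℝ, E) I (extChartAt I x).symm e v)
    (mfderiv 𝓘(ℝ, E) I (extChartAt I x).symm e w)

/-- `g` is a (smooth) semi-Riemannian metric. -/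
structure IsSemiRiemannianMetric (g : BilinField I M) : Prop where
  symm : ∀ x, (g x).IsSymm
  nondegenerate : ∀ x, (g x).Nondegenerate
  smooth : ∀ (x : M) (v w : E),
    ContDiffOn ℝ ∞ (metricCoeff g x v w) (extChartAt I x).target

/-- The Christoffel symbol of the first kind at `x`, in the chart around `x`:
`½ (D_X g(Y, Z) + D_Y g(X, Z) - D_Z g(X, Y))`. -/
def christoffelFirst (g : BilinField I M) (x : M) (X Y Z : E) : ℝ :=
  (fderiv ℝ (metricCoeff g x Y Z) (extChartAt I x x) X
    + fderiv ℝ (metricCoeff g x X Z) (extChartAt I x x) Y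
    - fderiv ℝ (metricCoeff g x X Y) (extChartAt I x x) Z) / 2

/-- The Christoffel symbol `Γ(X, Y)` of the Levi-Civita connection of `g` at `x`, in the chart
around `x`; tangent vectors at `x` are identified with their coordinates in this chart. -/
def christoffel (g : BilinField I M) (x : M) (X Y : TangentSpace I x) : TangentSpace I x :=
  sharp (g x) (fun Z => christoffelFirst g x X Y Z)

/-- The Levi-Civita derivative `∇_X N` at `x` of a vector field `N`, in coordinates
`D_X N + Γ(X, N)`. -/
def covDeriv (g : BilinField I M) (N : (x : M) → TangentSpace I x) (x : M)
    (X : TangentSpace I x) : TangentSpace I x :=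
  ofCoord I x (fderiv ℝ
      (fun e : E => (mfderiv I 𝓘(ℝ, E) (extChartAt I x) ((extChartAt I x).symm e)
        (N ((extChartAt I x).symm e)) : E))
      (extChartAt I x x) X)
    + christoffel g x X (N x)

/-! ## Geometry of a map into a semi-Riemannian manifold -/

variable {E' : Type*} [NormedAddCommGroup E'] [NormedSpace ℝ E'] [FiniteDimensional ℝ E']
  {H' : Type*} [TopologicalSpace H'] {J : ModelWithCorners ℝ E' H'}
  {N : Type*} [TopologicalSpace N] [ChartedSpace H' N]

/-- The induced bilinear form `γ = F^* g` on `T_x M`. -/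
def inducedMetric (g : BilinField J N) (F : M → N) : BilinField I M := fun x =>
  LinearMap.BilinForm.comp (g (F x))
    (mfderiv I J F x).toLinearMap (mfderiv I J F x).toLinearMap

/-- The component of `v ∈ T_{F x} N` normal to `dF(T_x M)`:
`v - γ^{ij} g(v, dF e_i) dF e_j`. -/
def normalPart (I : ModelWithCorners ℝ E H) (g : BilinField J N) (F : M → N) (x : M)
    (v : TangentSpace J (F x)) : TangentSpace J (F x) :=
  v - metricTrace (inducedMetric (I := I) g F x)
    (fun X Y => g (F x) v (mfderiv I J F x X) • mfderiv I J F x Y)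

/-- The second fundamental form `II(X, Y) = (∇_X dF(Y))^⊥` of `F`. Here `Y` is extended with
constant coordinates in the chart around `x`, so that `∇_X dF(Y)` has the coordinates
`D²F(X, Y) + Γ(dF X, dF Y)` in the charts around `x` and `F x`. -/
def secondFundamentalForm (g : BilinField J N) (F : M → N) (x : M)
    (X Y : TangentSpace I x) : TangentSpace J (F x) :=
  normalPart I g F x
    (ofCoord J (F x) (fderiv ℝ (fderiv ℝ (writtenInExtChartAt I J x F)) (extChartAt I x x) X Y)
      + christoffel g (F x) (mfderiv I J F x X) (mfderiv I J F x Y))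

/-- The mean curvature vector `H = tr_γ II` of `F` (not divided by the dimension). -/
def meanCurvatureVector (I : ModelWithCorners ℝ E H) (g : BilinField J N) (F : M → N) (x : M) :
    TangentSpace J (F x) :=
  metricTrace (inducedMetric (I := I) g F x) (secondFundamentalForm (I := I) g F x)

/-! ## Submersions and their fibers -/

/-- The vertical space `ker dπ_x`, tangent to the fiber of `π` through `x`. -/
def vertical (I : ModelWithCorners ℝ E H) (J : ModelWithCorners ℝ E' H') (π : M → N) (x : M) :
    Submodule ℝ (TangentSpace I x) :=
  LinearMap.ker (mfderiv I J π x).toLinearMap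

/-- `X ∈ T_x M` is horizontal: orthogonal to the fiber of `π`. -/
def IsHorizontal (J : ModelWithCorners ℝ E' H') (g : BilinField I M) (π : M → N) (x : M)
    (X : TangentSpace I x) : Prop :=
  ∀ V ∈ vertical I J π x, g x X V = 0

/-- `π : (M, g) → (N, h)` is a semi-Riemannian submersion: a smooth surjective submersion with
nondegenerate fibers whose differential preserves scalar products of horizontal vectors. -/
structure IsSemiRiemannianSubmersion (g : BilinField I M) (h : BilinField J N) (π : M → N) :
    Prop where
  smooth : ContMDiff I J ∞ π
  surjective : Function.Surjective π
  submersion : ∀ x, Function.Surjective (mfderiv I J π x)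
  fiber_nondegenerate : ∀ x, ((g x).restrict (vertical I J π x)).Nondegenerate
  isometry : ∀ x (X Y : TangentSpace I x), IsHorizontal J g π x X → IsHorizontal J g π x Y →
    h (π x) (mfderiv I J π x X) (mfderiv I J π x Y) = g x X Y

/-- The mean curvature `H_fib^ξ = ∑ ε_i g(∇_{e_i} ξ, e_i)` at `x` of the fibers of `π` in the
direction of the field `ξ` normal to them, where `(e_i)` is an orthonormal basis, with
`g(e_i, e_i) = ε_i`, of the tangent space at `x` of the fiber. -/
def fiberMeanCurvature (J : ModelWithCorners ℝ E' H') (g : BilinField I M) (π : M → N)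
    (ξ : (x : M) → TangentSpace I x) (x : M) : ℝ :=
  metricTrace ((g x).restrict (vertical I J π x))
    (fun U V => g x (covDeriv g ξ x (U : TangentSpace I x)) (V : TangentSpace I x))

/-- `X` is a basic vector field (of class `C¹`): horizontal, and `π`-related to a vector field
on the base. -/
structure IsBasic [IsManifold I 1 M] (J : ModelWithCorners ℝ E' H') (g : BilinField I M) (π : M → N)
    (X : (x : M) → TangentSpace I x) : Prop where
  contMDiff : ContMDiff I I.tangent 1 (fun x => (⟨x, X x⟩ : TangentBundle I M))
  horizontal : ∀ x, IsHorizontal J g π x (X x)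
  projectable : ∃ Y : (p : N) → TangentSpace J p, ∀ x, mfderiv I J π x (X x) = Y (π x)

/-- The fibers of `π` have constant mean curvature: the mean curvature in the direction of each
basic vector field is constant along every fiber (for fibers of codimension one this says that
each fiber is a hypersurface of constant mean curvature; in general, that the mean curvature
vector field of the fibers is basic). -/
def HasCMCFibers [IsManifold I 1 M] (J : ModelWithCorners ℝ E' H') (g : BilinField I M) (π : M → N) : Prop :=
  ∀ X : (x : M) → TangentSpace I x, IsBasic J g π X →
    ∀ x y : M, π x = π y → fiberMeanCurvature J g π X x = fiberMeanCurvature J g π X y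

/-! ## Graphs in the product with a line -/

/-- The product metric `g + ε dt²` on `M × ℝ`. -/
def prodMetric (g : BilinField I M) (ε : ℝ) : BilinField (I.prod 𝓘(ℝ, ℝ)) (M × ℝ) := fun q =>
  (LinearMap.BilinForm.comp (g q.1) (LinearMap.fst ℝ E ℝ) (LinearMap.fst ℝ E ℝ) +
    ε • LinearMap.BilinForm.comp (LinearMap.mul ℝ ℝ)
      (LinearMap.snd ℝ E ℝ) (LinearMap.snd ℝ E ℝ) : LinearMap.BilinForm ℝ (E × ℝ))

/-- The graph map `x ↦ (x, u x)`. -/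
def graphMap (u : M → ℝ) : M → M × ℝ := fun x => (x, u x)

/-- The vector field `∂_t` on `M × ℝ`. -/
def partialT (I : ModelWithCorners ℝ E H) {M : Type*} [TopologicalSpace M] [ChartedSpace H M]
    (q : M × ℝ) : TangentSpace (I.prod 𝓘(ℝ, ℝ)) q :=
  ((0, 1) : E × ℝ)

/-- The component `∂_t^⊥` of `∂_t` normal to the graph of `u`. -/
def partialTPerp (g : BilinField I M) (ε : ℝ) (u : M → ℝ) (x : M) :
    TangentSpace (I.prod 𝓘(ℝ, ℝ)) (graphMap u x) :=
  normalPart I (prodMetric g ε) (graphMap u) x (partialT I (graphMap u x))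

/-- The graph map of the `C²` function `u` is a translating soliton in `(M × ℝ, g + ε dt²)`:
the graph is a semi-Riemannian hypersurface with `H = ∂_t^⊥`. -/
structure IsGraphicalTranslatingSoliton (g : BilinField I M) (ε : ℝ) (u : M → ℝ) : Prop where
  contMDiff : ContMDiff I 𝓘(ℝ, ℝ) 2 u
  nondegenerate : ∀ x, (inducedMetric (I := I) (prodMetric g ε) (graphMap u) x).Nondegenerate
  equation : ∀ x, meanCurvatureVector I (prodMetric g ε) (graphMap u) x = partialTPerp g ε u x

/-- `ν` is the unit upward normal along the graph of `u`: orthogonal to the graph,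
`⟨ν, ν⟩ = ±1`, with positive `∂_t`-component. Such a `ν` exists only if the induced metric is
nondegenerate, and it is then unique. -/
structure IsUnitUpwardNormal (g : BilinField I M) (ε : ℝ) (u : M → ℝ)
    (ν : (x : M) → TangentSpace (I.prod 𝓘(ℝ, ℝ)) (graphMap u x)) : Prop where
  orthogonal : ∀ x (X : TangentSpace I x), prodMetric g ε (graphMap u x) (ν x)
    (mfderiv I (I.prod 𝓘(ℝ, ℝ)) (graphMap u) x X) = 0
  unit : ∀ x, prodMetric g ε (graphMap u x) (ν x) (ν x) = 1 ∨
    prodMetric g ε (graphMap u x) (ν x) (ν x) = -1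
  upward : ∀ x, 0 < (ν x : E × ℝ).2

/-- The extension of a vector field along the graph of `u` to a vector field on `M × ℝ` that is
invariant under the translations `(x, t) ↦ (x, t + s)`. -/
def translationExtension {u : M → ℝ}
    (ν : (x : M) → TangentSpace (I.prod 𝓘(ℝ, ℝ)) (graphMap u x)) (q : M × ℝ) :
    TangentSpace (I.prod 𝓘(ℝ, ℝ)) q :=
  (ν q.1 : E × ℝ)

end Manifold

end TransSoliton

end

/-!
Write the unit upward normal of the graph of `u` as `ν = (a, b)`. Orthogonality to the graph says
that `a` represents the form `-ε b du`, so the second fundamental form of the graph satisfies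
`⟨II(X, Y), ν⟩ = ε b Hess u(X, Y)`, and its trace `h` with respect to the induced metric determines
the mean curvature vector `⟨ν, ν⟩ h ν` (`meanCurvatureVector_eq`). Since
`∂_t^⊥ = ⟨ν, ν⟩ ε b ν` (`partialTPerp_eq`), the soliton equation is the scalar equation `h = ε b`.

Let `ν' = (a', b')` be the normal of the lifted graph. Linear algebra at a point shows that `a'` is
the horizontal lift of `a` and `b' = b ∘ π` (`normalAt_lift`), so `a'` is a basic field. It is of
class `C¹` because `u` is of class `C²` (`contDiffAt_unit_normal`); hence the hypothesis on the
fibers applies to `a'`. The covariant derivative of `ν'` in the product along a fiber of `π × 1`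
has the component `∇ a'` tangent to `M`, so the mean curvature of these fibers in the direction
`ν'` is that of the fibers of `π` in the direction `a'`
(`fiberMeanCurvature_prodMap`) and descends to the base.

It remains to compare the traces of `ε b' Hess (u ∘ π)` and `ε b Hess u`. The tangent spaces of `M`
split orthogonally into vertical and horizontal vectors, also for the metric induced on the graph,
since `u ∘ π` is constant on fibers. On vertical vectors `ε b' Hess (u ∘ π)(U, V)` equals
`-⟨∇_U a', V⟩` (`covariant_derivative_eq_hessian`), which contributes minus the mean curvature of
the fibers. On horizontal vectors it is the lift of `ε b Hess u`
(`hessianForm_comp_horizontal`). This is O'Neill's formula; in coordinates it holds because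
the symmetric form `g_M - π^* g_B` is annihilated by horizontal vectors, so that its derivatives
vanish on pairs of horizontal vectors (`fderiv_pullback_horizontal`). Therefore
`h' = h ∘ π - H_fib` (`graphMeanCurvature_lift`), and `h' = ε b'` becomes `h = ε b + H_fib`.
-/

set_option linter.unusedSectionVars false

namespace TransSoliton

open Filter Topology

/-! ### Metric contractions -/

section LinearAlgebra

variable {V W : Type*} [AddCommGroup V] [Module ℝ V] [FiniteDimensional ℝ V]
  [AddCommGroup W] [Module ℝ W]

theorem map_metricTrace {W' : Type*} [AddCommGroup W'] [Module ℝ W'] (f : W →ₗ[ℝ] W')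
    (γ : LinearMap.BilinForm ℝ V) (b : V → V → W) :
    f (metricTrace γ b) = metricTrace γ (fun v w => f (b v w)) := by
  simp [metricTrace, map_sum]

theorem bilinForm_metricTrace (B : LinearMap.BilinForm ℝ W) (γ : LinearMap.BilinForm ℝ V)
    (b : V → V → W) (z : W) :
    B (metricTrace γ b) z = metricTrace γ (fun v w => B (b v w) z) := by
  simp [metricTrace, map_sum, LinearMap.sum_apply]

theorem metricTrace_zero (γ : LinearMap.BilinForm ℝ V) :
    metricTrace γ (fun _ _ => (0 : W)) = 0 := by
  simp [metricTrace]

theorem metricTrace_neg (γ : LinearMap.BilinForm ℝ V) (b : V → V → W) :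
    metricTrace γ (fun v w => -b v w) = -metricTrace γ b := by
  simp [metricTrace]

/-- The metric contraction of a bilinear form as a trace of matrices, in an arbitrary basis. -/
theorem metricTrace_eq_trace {ι : Type*} [Fintype ι] [DecidableEq ι] (c : Module.Basis ι ℝ V)
    {γ : LinearMap.BilinForm ℝ V} (hγ : γ.Nondegenerate) (b : LinearMap.BilinForm ℝ V) :
    metricTrace γ (fun v w => b v w) =
      ((LinearMap.BilinForm.toMatrix c γ)⁻¹ * (LinearMap.BilinForm.toMatrix c b).transpose).trace
      := by
  set d := Module.finBasis ℝ V
  have hP : d.toMatrix c * c.toMatrix d = 1 := d.toMatrix_mul_toMatrix_flip c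
  have hQ : c.toMatrix d * d.toMatrix c = 1 := c.toMatrix_mul_toMatrix_flip d
  have hd : metricTrace γ (fun v w => b v w) =
      ((LinearMap.BilinForm.toMatrix d γ)⁻¹ *
        (LinearMap.BilinForm.toMatrix d b).transpose).trace := by
    simp [metricTrace, Matrix.trace, Matrix.mul_apply, d, LinearMap.BilinForm.toMatrix_apply]
  set P := c.toMatrix d
  set Q := d.toMatrix c
  rw [hd, ← LinearMap.BilinForm.toMatrix_mul_basis_toMatrix c d γ,
    ← LinearMap.BilinForm.toMatrix_mul_basis_toMatrix c d b]
  set A := LinearMap.BilinForm.toMatrix c γ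
  set B := LinearMap.BilinForm.toMatrix c b
  have hA : IsUnit A.det :=
    isUnit_iff_ne_zero.2 ((LinearMap.BilinForm.nondegenerate_iff_det_ne_zero c).1 hγ)
  have hinv : (P.transpose * A * P)⁻¹ = Q * A⁻¹ * Q.transpose := by
    refine Matrix.inv_eq_left_inv ?_
    calc Q * A⁻¹ * Q.transpose * (P.transpose * A * P)
        = Q * A⁻¹ * (P * Q).transpose * A * P := by
          simp only [Matrix.transpose_mul, Matrix.mul_assoc]
      _ = Q * (A⁻¹ * A) * P := by rw [hQ]; simp [Matrix.mul_assoc]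
      _ = 1 := by rw [Matrix.nonsing_inv_mul _ hA, Matrix.mul_one, hP]
  rw [hinv]
  calc (Q * A⁻¹ * Q.transpose * (P.transpose * B * P).transpose).trace
      = (Q * (A⁻¹ * ((P * Q).transpose * B.transpose * P))).trace := by
        simp only [Matrix.transpose_mul, Matrix.transpose_transpose, Matrix.mul_assoc]
    _ = (A⁻¹ * ((P * Q).transpose * B.transpose * (P * Q))).trace := by
        rw [Matrix.trace_mul_comm]; simp only [Matrix.mul_assoc]
    _ = (A⁻¹ * B.transpose).trace := by rw [hQ]; simp

/-- `α^♯` represents the linear form `α`. -/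
theorem apply_sharp {γ : LinearMap.BilinForm ℝ V} (hγ : γ.Nondegenerate) (α : V →ₗ[ℝ] ℝ) (w : V) :
    γ (sharp γ (fun v => α v)) w = α w := by
  set c := Module.finBasis ℝ V
  have hdet : IsUnit (LinearMap.BilinForm.toMatrix c γ).det := by
    have := (LinearMap.BilinForm.nondegenerate_iff_det_ne_zero c).1 hγ
    exact isUnit_iff_ne_zero.2 this
  have key : (γ (sharp γ (fun v => α v))) = α := by
    refine c.ext fun k => ?_
    have h1 := Matrix.nonsing_inv_mul _ hdet
    have h2 : ∀ i, ∑ j, (LinearMap.BilinForm.toMatrix c γ)⁻¹ i j * γ (c j) (c k) =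
        if i = k then 1 else 0 := fun i => by
      have := congrFun (congrFun h1 i) k
      simpa [Matrix.mul_apply, LinearMap.BilinForm.toMatrix_apply, Matrix.one_apply] using this
    have h3 : γ (sharp γ (fun v => α v)) (c k) =
        ∑ i, α (c i) * ∑ j, (LinearMap.BilinForm.toMatrix c γ)⁻¹ i j * γ (c j) (c k) := by
      simp only [sharp, metricTrace, map_sum, LinearMap.sum_apply, map_smul, LinearMap.smul_apply,
        smul_eq_mul, Finset.mul_sum]
      refine Finset.sum_congr rfl fun i _ => Finset.sum_congr rfl fun j _ => ?_
      ring
    rw [h3]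
    simp [h2]
  rw [key]

/-- Metric contractions split along an orthogonal decomposition. -/
theorem metricTrace_prod {V₁ V₂ : Type*} [AddCommGroup V₁] [Module ℝ V₁] [FiniteDimensional ℝ V₁]
    [AddCommGroup V₂] [Module ℝ V₂] [FiniteDimensional ℝ V₂] (L : (V₁ × V₂) ≃ₗ[ℝ] V)
    {γ b : LinearMap.BilinForm ℝ V} {γ₁ b₁ : LinearMap.BilinForm ℝ V₁}
    {γ₂ b₂ : LinearMap.BilinForm ℝ V₂} (hγ₁ : γ₁.Nondegenerate) (hγ₂ : γ₂.Nondegenerate)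
    (h₁₁ : ∀ v w, γ (L (v, 0)) (L (w, 0)) = γ₁ v w)
    (h₂₂ : ∀ v w, γ (L (0, v)) (L (0, w)) = γ₂ v w)
    (h₁₂ : ∀ v w, γ (L (v, 0)) (L (0, w)) = 0)
    (h₂₁ : ∀ v w, γ (L (0, v)) (L (w, 0)) = 0)
    (hb₁ : ∀ v w, b (L (v, 0)) (L (w, 0)) = b₁ v w)
    (hb₂ : ∀ v w, b (L (0, v)) (L (0, w)) = b₂ v w) :
    metricTrace γ (fun v w => b v w) =
      metricTrace γ₁ (fun v w => b₁ v w) + metricTrace γ₂ (fun v w => b₂ v w) := by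
  set c₁ := Module.finBasis ℝ V₁
  set c₂ := Module.finBasis ℝ V₂
  set c := (c₁.prod c₂).map L
  have d₁ : IsUnit (LinearMap.BilinForm.toMatrix c₁ γ₁).det :=
    isUnit_iff_ne_zero.2 ((LinearMap.BilinForm.nondegenerate_iff_det_ne_zero c₁).1 hγ₁)
  have d₂ : IsUnit (LinearMap.BilinForm.toMatrix c₂ γ₂).det :=
    isUnit_iff_ne_zero.2 ((LinearMap.BilinForm.nondegenerate_iff_det_ne_zero c₂).1 hγ₂)
  have hA : LinearMap.BilinForm.toMatrix c γ = Matrix.fromBlocks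
      (LinearMap.BilinForm.toMatrix c₁ γ₁) 0 0 (LinearMap.BilinForm.toMatrix c₂ γ₂) := by
    ext (i | i) (j | j) <;> simp [LinearMap.BilinForm.toMatrix_apply, c, h₁₁, h₂₂, h₁₂, h₂₁]
  have hinv : (LinearMap.BilinForm.toMatrix c γ)⁻¹ = Matrix.fromBlocks
      (LinearMap.BilinForm.toMatrix c₁ γ₁)⁻¹ 0 0 (LinearMap.BilinForm.toMatrix c₂ γ₂)⁻¹ := by
    refine Matrix.inv_eq_left_inv ?_
    rw [hA, Matrix.fromBlocks_multiply]
    simp [Matrix.nonsing_inv_mul _ d₁, Matrix.nonsing_inv_mul _ d₂]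
  have hγ : γ.Nondegenerate := by
    rw [LinearMap.BilinForm.nondegenerate_iff_det_ne_zero c, hA, Matrix.det_fromBlocks_zero₂₁]
    exact (d₁.mul d₂).ne_zero
  rw [metricTrace_eq_trace c hγ, metricTrace_eq_trace c₁ hγ₁, metricTrace_eq_trace c₂ hγ₂, hinv]
  simp only [Matrix.trace, Matrix.diag, Matrix.mul_apply, Fintype.sum_sum_type,
    Matrix.transpose_apply, Matrix.fromBlocks_apply₁₁, Matrix.fromBlocks_apply₁₂,
    Matrix.fromBlocks_apply₂₁, Matrix.fromBlocks_apply₂₂, Matrix.zero_apply, zero_mul,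
    Finset.sum_const_zero, add_zero, zero_add, LinearMap.BilinForm.toMatrix_apply]
  simp [c, hb₁, hb₂]

theorem metricTrace_congr {V' : Type*} [AddCommGroup V'] [Module ℝ V'] [FiniteDimensional ℝ V']
    (L : V ≃ₗ[ℝ] V') {γ b : LinearMap.BilinForm ℝ V} {γ' b' : LinearMap.BilinForm ℝ V'}
    (hγ₀ : γ.Nondegenerate)
    (hγ : ∀ v w, γ' (L v) (L w) = γ v w) (hb : ∀ v w, b' (L v) (L w) = b v w) :
    metricTrace γ' (fun v w => b' v w) = metricTrace γ (fun v w => b v w) := by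
  set c := Module.finBasis ℝ V
  have h : ∀ {a : LinearMap.BilinForm ℝ V} {a' : LinearMap.BilinForm ℝ V'},
      (∀ v w, a' (L v) (L w) = a v w) →
      LinearMap.BilinForm.toMatrix (c.map L) a' = LinearMap.BilinForm.toMatrix c a := by
    intro a a' h
    ext i j
    simp [LinearMap.BilinForm.toMatrix_apply, h]
  have hγ₀' : γ'.Nondegenerate := by
    rw [LinearMap.BilinForm.nondegenerate_iff_det_ne_zero (c.map L), h hγ]
    exact (LinearMap.BilinForm.nondegenerate_iff_det_ne_zero c).1 hγ₀
  rw [metricTrace_eq_trace c hγ₀, metricTrace_eq_trace (c.map L) hγ₀', h hγ, h hb]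

end LinearAlgebra

/-! ### The Hessian and Riemannian submersions in coordinates -/

section Euclidean

variable {E : Type*} [NormedAddCommGroup E] [NormedSpace ℝ E]
  {F : Type*} [NormedAddCommGroup F] [NormedSpace ℝ F]

variable [FiniteDimensional ℝ E] in
/-- A nondegenerate `C^n` field of bilinear forms can be inverted in a `C^n` way: raising an index
preserves the differentiability class. -/
theorem exists_contDiffAt_inverse {D : Type*} [NormedAddCommGroup D] [NormedSpace ℝ D]
    {n : WithTop ℕ∞} {G : D → E →L[ℝ] E →L[ℝ] ℝ} {e₀ : D} (hG : ContDiffAt ℝ n G e₀)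
    (hinj : Function.Injective (G e₀)) :
    ∃ R : D → (E →L[ℝ] ℝ) →L[ℝ] E, ContDiffAt ℝ n R e₀ ∧
      ∀ᶠ e in 𝓝 e₀, (∀ v, R e (G e v) = v) ∧ ∀ α, G e (R e α) = α := by
  have hfin : Module.finrank ℝ E = Module.finrank ℝ (E →L[ℝ] ℝ) := by
    rw [← (LinearMap.toContinuousLinearMap (𝕜 := ℝ) (E := E) (F' := ℝ)).finrank_eq]
    exact (Subspace.dual_finrank_eq (K := ℝ) (V := E)).symm
  let A : E ≃L[ℝ] (E →L[ℝ] ℝ) :=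
    (LinearEquiv.ofInjectiveOfFinrankEq (G e₀).toLinearMap hinj hfin).toContinuousLinearEquiv
  have hA : (A : E →L[ℝ] (E →L[ℝ] ℝ)) = G e₀ := by
    ext v w
    rfl
  have : CompleteSpace E := FiniteDimensional.complete ℝ E
  refine ⟨fun e => (G e).inverse, ?_, ?_⟩
  · have := contDiffAt_map_inverse (n := n) A
    rw [hA] at this
    exact this.comp e₀ hG
  · have h := ContinuousLinearEquiv.nhds A
    rw [hA] at h
    filter_upwards [hG.continuousAt h] with e he
    obtain ⟨A', hA'⟩ := he
    have hA' : (A' : E →L[ℝ] (E →L[ℝ] ℝ)) = G e := hA'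
    rw [← hA', ContinuousLinearMap.inverse_equiv]
    simp

/-- The Christoffel symbol of the first kind of a field of bilinear forms on a vector space. -/
noncomputable def christoffelAt (G : E → E →L[ℝ] E →L[ℝ] ℝ) (e X Y Z : E) : ℝ :=
  (fderiv ℝ G e X Y Z + fderiv ℝ G e Y X Z - fderiv ℝ G e Z X Y) / 2

/-- The Christoffel symbol of the first kind as a linear form in its last argument. -/
noncomputable def christoffelForm (G : E → E →L[ℝ] E →L[ℝ] ℝ) (e X Y : E) : E →ₗ[ℝ] ℝ where
  toFun Z := christoffelAt G e X Y Z
  map_add' Z Z' := by simp only [christoffelAt, map_add, add_apply]; ring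
  map_smul' r Z := by
    simp only [christoffelAt, map_smul, smul_apply, smul_eq_mul,
      RingHom.id_apply]
    ring

/-- The bilinear form `c D²u + Γ(·, ·; a)`. If `a` represents the form `-c du`, it is `c` times the
Hessian of `u` with respect to `G`. -/
noncomputable def hessianForm (G : E → E →L[ℝ] E →L[ℝ] ℝ) (u : E → ℝ) (e a : E) (c : ℝ) :
    LinearMap.BilinForm ℝ E :=
  LinearMap.mk₂ ℝ (fun X Y => c * fderiv ℝ (fderiv ℝ u) e X Y + christoffelAt G e X Y a)
    (fun X X' Y => by simp only [christoffelAt, map_add, add_apply]; ring)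
    (fun r X Y => by simp only [christoffelAt, map_smul, smul_apply, smul_eq_mul]; ring)
    (fun X Y Y' => by simp only [christoffelAt, map_add, add_apply]; ring)
    (fun r X Y => by simp only [christoffelAt, map_smul, smul_apply, smul_eq_mul]; ring)

theorem hessianForm_apply (G : E → E →L[ℝ] E →L[ℝ] ℝ) (u : E → ℝ) (e a : E) (c : ℝ) (X Y : E) :
    hessianForm G u e a c X Y =
      c * fderiv ℝ (fderiv ℝ u) e X Y + christoffelAt G e X Y a := rfl

theorem hessianForm_congr {G : E → E →L[ℝ] E →L[ℝ] ℝ} {u u' : E → ℝ} {e a : E} {c : ℝ}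
    (h : u =ᶠ[𝓝 e] u') : hessianForm G u e a c = hessianForm G u' e a c := by
  ext X Y
  rw [hessianForm_apply, hessianForm_apply, h.fderiv.fderiv_eq]

variable [FiniteDimensional ℝ E] in
/-- Let `K` be a metric whose pull-back under `P` agrees with the metric `G` on pairs one member of
which is horizontal. Then the derivatives of the two forms agree at horizontal vectors, because the
difference `G - P^*K` is annihilated by horizontal vectors everywhere. -/
theorem fderiv_pullback_horizontal {G : E → E →L[ℝ] E →L[ℝ] ℝ} {K : F → F →L[ℝ] F →L[ℝ] ℝ}
    {P : E → F} {e₀ : E} (hG : ContDiffAt ℝ 1 G e₀) (hK : ContDiffAt ℝ 1 K (P e₀))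
    (hP : ContDiffAt ℝ 2 P e₀) (hinj : Function.Injective (G e₀))
    (hsymm : ∀ v w, G e₀ v w = G e₀ w v)
    (hKsymm : ∀ v w, K (P e₀) v w = K (P e₀) w v)
    (hiso : ∀ᶠ e in 𝓝 e₀, ∀ X, (∀ V, fderiv ℝ P e V = 0 → G e X V = 0) →
      ∀ w, K (P e) (fderiv ℝ P e X) (fderiv ℝ P e w) = G e X w)
    {X Y : E} (hX : ∀ V, fderiv ℝ P e₀ V = 0 → G e₀ X V = 0)
    (hY : ∀ V, fderiv ℝ P e₀ V = 0 → G e₀ Y V = 0) (Z : E) :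
    fderiv ℝ G e₀ Z X Y =
      fderiv ℝ K (P e₀) (fderiv ℝ P e₀ Z) (fderiv ℝ P e₀ X) (fderiv ℝ P e₀ Y) +
      K (P e₀) (fderiv ℝ (fderiv ℝ P) e₀ Z X) (fderiv ℝ P e₀ Y) +
      K (P e₀) (fderiv ℝ P e₀ X) (fderiv ℝ (fderiv ℝ P) e₀ Z Y) := by
  obtain ⟨R, hR, hRG⟩ := exists_contDiffAt_inverse hG hinj
  have hP' : ContDiffAt ℝ 1 (fderiv ℝ P) e₀ := hP.fderiv_right (by norm_num)
  set β : F →L[ℝ] ℝ := K (P e₀) (fderiv ℝ P e₀ X) with hβ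
  -- The field representing the pull-backs of the covector `β` is a horizontal extension of `X`.
  set ξ : E → E := fun e => R e (β.comp (fderiv ℝ P e)) with hξ
  have hξd : DifferentiableAt ℝ ξ e₀ :=
    ((hR.clm_apply (contDiffAt_const.clm_comp hP')).differentiableAt one_ne_zero)
  have hξG : ∀ᶠ e in 𝓝 e₀, ∀ w, G e (ξ e) w = β (fderiv ℝ P e w) := by
    filter_upwards [hRG] with e he w
    rw [hξ, he.2]
    rfl
  have hξ₀ : ξ e₀ = X := by
    have h : G e₀ X = β.comp (fderiv ℝ P e₀) := by
      ext w
      exact (hiso.self_of_nhds X hX w).symm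
    rw [hξ]
    simp only
    rw [← h]
    exact hRG.self_of_nhds.1 X
  have dG : HasFDerivAt G (fderiv ℝ G e₀) e₀ := (hG.differentiableAt one_ne_zero).hasFDerivAt
  have dK : HasFDerivAt (fun e => K (P e)) ((fderiv ℝ K (P e₀)).comp (fderiv ℝ P e₀)) e₀ :=
    (hK.differentiableAt one_ne_zero).hasFDerivAt.comp e₀
      (hP.differentiableAt two_ne_zero).hasFDerivAt
  have dP : HasFDerivAt (fderiv ℝ P) (fderiv ℝ (fderiv ℝ P) e₀) e₀ :=
    (hP'.differentiableAt one_ne_zero).hasFDerivAt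
  have dξ := hξd.hasFDerivAt
  have c (v : E) := hasFDerivAt_const (𝕜 := ℝ) v e₀
  have key : HasFDerivAt (fun e => G e (ξ e) Y - K (P e) (fderiv ℝ P e (ξ e)) (fderiv ℝ P e Y))
      (0 : E →L[ℝ] ℝ) e₀ := by
    refine (hasFDerivAt_const (0 : ℝ) e₀).congr_of_eventuallyEq ?_
    filter_upwards [hiso, hξG] with e h₁ h₂
    rw [h₁ (ξ e) (fun V hV => by rw [h₂, hV, map_zero]) Y, sub_self]
  have d₁ := ((dG.clm_apply dξ).clm_apply (c Y)).sub
    ((dK.clm_apply (dP.clm_apply dξ)).clm_apply (dP.clm_apply (c Y)))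
  have h := congrArg (fun T : E →L[ℝ] ℝ => T Z) (d₁.unique key)
  have h0 : K (P e₀) (fderiv ℝ P e₀ (fderiv ℝ ξ e₀ Z)) (fderiv ℝ P e₀ Y) =
      G e₀ (fderiv ℝ ξ e₀ Z) Y := by
    rw [hKsymm, hsymm, hiso.self_of_nhds Y hY]
  simp [hξ₀, h0] at h
  linarith

variable [FiniteDimensional ℝ E] in
/-- O'Neill's formula in coordinates: for horizontal vectors the Christoffel symbols of the total
space and of the base differ by the second derivative of the submersion. -/
theorem christoffelAt_horizontal {G : E → E →L[ℝ] E →L[ℝ] ℝ} {K : F → F →L[ℝ] F →L[ℝ] ℝ}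
    {P : E → F} {e₀ : E} (hG : ContDiffAt ℝ 1 G e₀) (hK : ContDiffAt ℝ 1 K (P e₀))
    (hP : ContDiffAt ℝ 2 P e₀) (hinj : Function.Injective (G e₀))
    (hsymm : ∀ v w, G e₀ v w = G e₀ w v)
    (hKsymm : ∀ v w, K (P e₀) v w = K (P e₀) w v)
    (hiso : ∀ᶠ e in 𝓝 e₀, ∀ X, (∀ V, fderiv ℝ P e V = 0 → G e X V = 0) →
      ∀ w, K (P e) (fderiv ℝ P e X) (fderiv ℝ P e w) = G e X w)
    {X Y Z : E} (hX : ∀ V, fderiv ℝ P e₀ V = 0 → G e₀ X V = 0)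
    (hY : ∀ V, fderiv ℝ P e₀ V = 0 → G e₀ Y V = 0)
    (hZ : ∀ V, fderiv ℝ P e₀ V = 0 → G e₀ Z V = 0) :
    christoffelAt G e₀ X Y Z =
      christoffelAt K (P e₀) (fderiv ℝ P e₀ X) (fderiv ℝ P e₀ Y) (fderiv ℝ P e₀ Z) +
      K (P e₀) (fderiv ℝ (fderiv ℝ P) e₀ X Y) (fderiv ℝ P e₀ Z) := by
  have h {X Y : E} (hX : ∀ V, fderiv ℝ P e₀ V = 0 → G e₀ X V = 0)
      (hY : ∀ V, fderiv ℝ P e₀ V = 0 → G e₀ Y V = 0) :=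
    fderiv_pullback_horizontal hG hK hP hinj hsymm hKsymm hiso hX hY
  have hs : IsSymmSndFDerivAt ℝ P e₀ := hP.isSymmSndFDerivAt (by simp)
  rw [christoffelAt, christoffelAt, h hY hZ, h hX hZ, h hX hY, hs Y X, hs Z X, hs Z Y,
    hKsymm (fderiv ℝ P e₀ Y) (fderiv ℝ (fderiv ℝ P) e₀ X Z),
    hKsymm (fderiv ℝ P e₀ X) (fderiv ℝ (fderiv ℝ P) e₀ Y Z)]
  ring

/-- Let the vector field `ξ` represent the form `β du`. On vectors annihilated by `du`, the
covariant derivative of `ξ` is `β` times the Hessian of `u`; in particular its pairing with such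
vectors at a point depends on the values of `ξ` and `β` there only. -/
theorem covariant_derivative_eq_hessian {G : E → E →L[ℝ] E →L[ℝ] ℝ} {ξ : E → E} {β u : E → ℝ}
    {e₀ : E} (hG : ContDiffAt ℝ 1 G e₀) (hξ : DifferentiableAt ℝ ξ e₀)
    (hβ : DifferentiableAt ℝ β e₀) (hu : ContDiffAt ℝ 2 u e₀)
    (h : ∀ᶠ e in 𝓝 e₀, ∀ w, G e (ξ e) w = β e * fderiv ℝ u e w)
    (hsymm : ∀ᶠ e in 𝓝 e₀, ∀ v w, G e v w = G e w v)
    {U V : E} (hV : fderiv ℝ u e₀ V = 0) :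
    G e₀ (fderiv ℝ ξ e₀ U) V + christoffelAt G e₀ U (ξ e₀) V =
      -hessianForm G u e₀ (ξ e₀) (-β e₀) U V := by
  have dG : HasFDerivAt G (fderiv ℝ G e₀) e₀ := (hG.differentiableAt one_ne_zero).hasFDerivAt
  have du : HasFDerivAt (fderiv ℝ u) (fderiv ℝ (fderiv ℝ u) e₀) e₀ :=
    ((hu.fderiv_right (m := 1) (by norm_num)).differentiableAt one_ne_zero).hasFDerivAt
  have c (v : E) := hasFDerivAt_const (𝕜 := ℝ) v e₀
  have d₁ := (dG.clm_apply hξ.hasFDerivAt).clm_apply (c V)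
  have d₂ := hβ.hasFDerivAt.mul (du.clm_apply (c V))
  have h₁ := congrArg (fun T : E →L[ℝ] ℝ => T U)
    (d₁.unique (d₂.congr_of_eventuallyEq (h.mono fun e he => he V)))
  -- The derivatives of `G` are symmetric as well.
  have hs (a v w : E) : fderiv ℝ G e₀ a v w = fderiv ℝ G e₀ a w v := by
    have e₁ := (dG.clm_apply (c v)).clm_apply (c w)
    have e₂ := (dG.clm_apply (c w)).clm_apply (c v)
    have := congrArg (fun T : E →L[ℝ] ℝ => T a)
      (e₁.unique (e₂.congr_of_eventuallyEq (hsymm.mono fun e he => he v w)))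
    simpa using this
  simp [hV] at h₁
  rw [hessianForm_apply, christoffelAt, christoffelAt, hs (ξ e₀) U V, hs U V (ξ e₀), hs V U]
  linarith

theorem fderiv_fderiv_comp {u : F → ℝ} {P : E → F} {e₀ : E} (hu : ContDiffAt ℝ 2 u (P e₀))
    (hP : ContDiffAt ℝ 2 P e₀) (X Y : E) :
    fderiv ℝ (fderiv ℝ (u ∘ P)) e₀ X Y =
      fderiv ℝ (fderiv ℝ u) (P e₀) (fderiv ℝ P e₀ X) (fderiv ℝ P e₀ Y) +
      fderiv ℝ u (P e₀) (fderiv ℝ (fderiv ℝ P) e₀ X Y) := by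
  have hev : fderiv ℝ (u ∘ P) =ᶠ[𝓝 e₀] fun e => (fderiv ℝ u (P e)).comp (fderiv ℝ P e) := by
    filter_upwards [hP.continuousAt.eventually (hu.eventually (by simp)), hP.eventually (by simp)]
      with e h₁ h₂
    exact fderiv_comp e (h₁.differentiableAt two_ne_zero) (h₂.differentiableAt two_ne_zero)
  have d₁ : HasFDerivAt (fun e => fderiv ℝ u (P e))
      ((fderiv ℝ (fderiv ℝ u) (P e₀)).comp (fderiv ℝ P e₀)) e₀ :=
    ((hu.fderiv_right (m := 1) (by norm_num)).differentiableAt one_ne_zero).hasFDerivAt.comp e₀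
      (hP.differentiableAt two_ne_zero).hasFDerivAt
  have d₂ : HasFDerivAt (fderiv ℝ P) (fderiv ℝ (fderiv ℝ P) e₀) e₀ :=
    ((hP.fderiv_right (m := 1) (by norm_num)).differentiableAt one_ne_zero).hasFDerivAt
  rw [hev.fderiv_eq, (d₁.clm_comp d₂).fderiv]
  simp
  ring

variable [FiniteDimensional ℝ E] in
/-- The Hessian of a function lifted from the base agrees with the Hessian on the base on horizontal
vectors. -/
theorem hessianForm_comp_horizontal {G : E → E →L[ℝ] E →L[ℝ] ℝ} {K : F → F →L[ℝ] F →L[ℝ] ℝ}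
    {P : E → F} {e₀ : E} (hG : ContDiffAt ℝ 1 G e₀) (hK : ContDiffAt ℝ 1 K (P e₀))
    (hP : ContDiffAt ℝ 2 P e₀) (hinj : Function.Injective (G e₀))
    (hsymm : ∀ v w, G e₀ v w = G e₀ w v)
    (hKsymm : ∀ v w, K (P e₀) v w = K (P e₀) w v)
    (hiso : ∀ᶠ e in 𝓝 e₀, ∀ X, (∀ V, fderiv ℝ P e V = 0 → G e X V = 0) →
      ∀ w, K (P e) (fderiv ℝ P e X) (fderiv ℝ P e w) = G e X w)
    {u : F → ℝ} (hu : ContDiffAt ℝ 2 u (P e₀)) {c : ℝ} {X Y a : E}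
    (hX : ∀ V, fderiv ℝ P e₀ V = 0 → G e₀ X V = 0)
    (hY : ∀ V, fderiv ℝ P e₀ V = 0 → G e₀ Y V = 0)
    (ha : ∀ V, fderiv ℝ P e₀ V = 0 → G e₀ a V = 0)
    (hau : ∀ w, K (P e₀) (fderiv ℝ P e₀ a) w = -c * fderiv ℝ u (P e₀) w) :
    hessianForm G (u ∘ P) e₀ a c X Y =
      hessianForm K u (P e₀) (fderiv ℝ P e₀ a) c (fderiv ℝ P e₀ X) (fderiv ℝ P e₀ Y) := by
  rw [hessianForm_apply, hessianForm_apply, fderiv_fderiv_comp hu hP,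
    christoffelAt_horizontal hG hK hP hinj hsymm hKsymm hiso hX hY ha, hKsymm _ (fderiv ℝ P e₀ a),
    hau]
  ring

variable [FiniteDimensional ℝ E] in
/-- If a field `ξ` represents `-ε β du` with `β > 0` and the vectors `(ξ, β)` have length `±1` with
respect to `G + ε dt²`, then `ξ` and `β` are one time less differentiable than `u`: indeed
`β⁻² = |ε² |du|² + ε|`. -/
theorem contDiffAt_unit_normal {G : E → E →L[ℝ] E →L[ℝ] ℝ} {ξ : E → E} {β u : E → ℝ} {ε : ℝ}
    {e₀ : E} (hG : ContDiffAt ℝ 1 G e₀) (hinj : Function.Injective (G e₀))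
    (hu : ContDiffAt ℝ 2 u e₀)
    (h : ∀ᶠ e in 𝓝 e₀, ∀ w, G e (ξ e) w = -(ε * β e) * fderiv ℝ u e w)
    (hunit : ∀ᶠ e in 𝓝 e₀, |G e (ξ e) (ξ e) + ε * (β e * β e)| = 1)
    (hpos : ∀ᶠ e in 𝓝 e₀, 0 < β e) :
    ContDiffAt ℝ 1 β e₀ ∧ ContDiffAt ℝ 1 ξ e₀ := by
  obtain ⟨R, hR, hRG⟩ := exists_contDiffAt_inverse hG hinj
  have hu' : ContDiffAt ℝ 1 (fderiv ℝ u) e₀ := hu.fderiv_right (by norm_num)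
  have hgrad : ContDiffAt ℝ 1 (fun e => R e (fderiv ℝ u e)) e₀ := hR.clm_apply hu'
  set W : E → ℝ := fun e => ε ^ 2 * fderiv ℝ u e (R e (fderiv ℝ u e)) + ε with hW
  have hWd : ContDiffAt ℝ 1 W e₀ :=
    (contDiffAt_const.mul (hu'.clm_apply hgrad)).add contDiffAt_const
  have hξ : ∀ᶠ e in 𝓝 e₀, ξ e = -(ε * β e) • R e (fderiv ℝ u e) := by
    filter_upwards [h, hRG] with e he hRe
    have : G e (ξ e) = -(ε * β e) • fderiv ℝ u e := ContinuousLinearMap.ext fun w => by simp [he w]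
    rw [← hRe.1 (ξ e), this, map_smul]
  have hβW : ∀ᶠ e in 𝓝 e₀, β e ^ 2 * |W e| = 1 := by
    filter_upwards [h, hξ, hunit] with e he hξe h1
    rw [← h1, he (ξ e), hξe, map_smul, smul_eq_mul, ← abs_of_nonneg (sq_nonneg (β e)), ← abs_mul]
    congr 1
    simp only [hW]
    ring
  have hβ : β =ᶠ[𝓝 e₀] fun e => (√|W e|)⁻¹ := by
    filter_upwards [hβW, hpos] with e h1 h2
    have h3 : 0 < |W e| := by
      by_contra h4
      have : |W e| = 0 := le_antisymm (not_lt.1 h4) (abs_nonneg _)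
      rw [this] at h1
      simp at h1
    have h4 : (β e * √|W e|) ^ 2 = 1 := by rw [mul_pow, Real.sq_sqrt h3.le, h1]
    have h5 : β e * √|W e| = 1 :=
      (pow_eq_one_iff_of_nonneg (mul_nonneg h2.le (Real.sqrt_nonneg _)) two_ne_zero).1 h4
    exact eq_inv_of_mul_eq_one_left h5
  have hW₀ : W e₀ ≠ 0 := fun h0 => by
    have := hβW.self_of_nhds
    simp [h0] at this
  have hβd : ContDiffAt ℝ 1 β e₀ := by
    refine ContDiffAt.congr_of_eventuallyEq ?_ hβ
    have h1 : ContDiffAt ℝ 1 (fun e => |W e|) e₀ := hWd.abs hW₀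
    exact (h1.sqrt (abs_ne_zero.2 hW₀)).inv (Real.sqrt_ne_zero'.2 (abs_pos.2 hW₀))
  refine ⟨hβd, ContDiffAt.congr_of_eventuallyEq ?_ hξ⟩
  exact (contDiffAt_const.mul hβd).neg.smul hgrad

end Euclidean

/-! ### Metrics and Christoffel symbols in charts -/

section Charts

variable {E : Type*} [NormedAddCommGroup E] [NormedSpace ℝ E] [FiniteDimensional ℝ E]
  {M : Type*} [TopologicalSpace M] [ChartedSpace E M]

/-- The derivative of the inverse of the chart around `x`, which maps coordinates of tangent
vectors to tangent vectors. -/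
noncomputable def frame (x : M) (e : E) : E →L[ℝ] E :=
  mfderiv 𝓘(ℝ, E) 𝓘(ℝ, E) (extChartAt 𝓘(ℝ, E) x).symm e

/-- The derivative of the chart around `x`, which maps tangent vectors to their coordinates. -/
noncomputable def coframe (x y : M) : E →L[ℝ] E :=
  mfderiv 𝓘(ℝ, E) 𝓘(ℝ, E) (extChartAt 𝓘(ℝ, E) x) y

variable [IsManifold 𝓘(ℝ, E) ∞ M]

theorem mdifferentiableAt_extChartAt_symm {x : M} {e : E} (he : e ∈ (extChartAt 𝓘(ℝ, E) x).target) :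
    MDifferentiableAt 𝓘(ℝ, E) 𝓘(ℝ, E) (extChartAt 𝓘(ℝ, E) x).symm e := by
  have : IsManifold 𝓘(ℝ, E) 1 M := IsManifold.of_le (n := ∞) (by simp)
  have := mdifferentiableWithinAt_extChartAt_symm he
  simpa [mdifferentiableWithinAt_univ] using this

theorem frame_self (x : M) : frame x (extChartAt 𝓘(ℝ, E) x x) = ContinuousLinearMap.id ℝ E := by
  have : IsManifold 𝓘(ℝ, E) 1 M := IsManifold.of_le (n := ∞) (by simp)
  have := mfderivWithin_range_extChartAt_symm (I := 𝓘(ℝ, E)) (x := x)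
  rwa [ModelWithCorners.range_eq_univ, mfderivWithin_univ] at this

theorem coframe_frame {x : M} {e : E} (he : e ∈ (extChartAt 𝓘(ℝ, E) x).target) (v : E) :
    coframe x ((extChartAt 𝓘(ℝ, E) x).symm e) (frame x e v) = v := by
  have : IsManifold 𝓘(ℝ, E) 1 M := IsManifold.of_le (n := ∞) (by simp)
  have := mfderiv_extChartAt_comp_mfderivWithin_extChartAt_symm he
  rw [ModelWithCorners.range_eq_univ, mfderivWithin_univ] at this
  exact congrArg (fun T : E →L[ℝ] E => T v) this

theorem frame_coframe {x : M} {e : E} (he : e ∈ (extChartAt 𝓘(ℝ, E) x).target) (v : E) :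
    frame x e (coframe x ((extChartAt 𝓘(ℝ, E) x).symm e) v) = v := by
  have : IsManifold 𝓘(ℝ, E) 1 M := IsManifold.of_le (n := ∞) (by simp)
  have := mfderivWithin_extChartAt_symm_comp_mfderiv_extChartAt he
  rw [ModelWithCorners.range_eq_univ, mfderivWithin_univ] at this
  exact congrArg (fun T : E →L[ℝ] E => T v) this

/-- The scalar product on the tangent space at `x`, with this space identified with the model
space. -/
def metricAt (g : BilinField 𝓘(ℝ, E) M) (x : M) : LinearMap.BilinForm ℝ E := g x

/-- The metric in the chart around `x`, as a field of bilinear forms on the model space. -/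
noncomputable def localMetric (g : BilinField 𝓘(ℝ, E) M) (x : M) (e : E) : E →L[ℝ] E →L[ℝ] ℝ :=
  LinearMap.toContinuousBilinearMap (LinearMap.BilinForm.comp
    (metricAt g ((extChartAt 𝓘(ℝ, E) x).symm e))
    (frame x e).toLinearMap (frame x e).toLinearMap)

theorem localMetric_apply (g : BilinField 𝓘(ℝ, E) M) (x : M) (e v w : E) :
    localMetric g x e v w =
      metricAt g ((extChartAt 𝓘(ℝ, E) x).symm e) (frame x e v) (frame x e w) := rfl

theorem metricCoeff_eq (g : BilinField 𝓘(ℝ, E) M) (x : M) (v w : E) :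
    metricCoeff g x v w = fun e => localMetric g x e v w := rfl

theorem localMetric_self (g : BilinField 𝓘(ℝ, E) M) (x : M) (v w : E) :
    localMetric g x (extChartAt 𝓘(ℝ, E) x x) v w = metricAt g x v w := by
  rw [localMetric_apply, frame_self, extChartAt_to_inv]
  rfl

variable {g : BilinField 𝓘(ℝ, E) M} (hg : IsSemiRiemannianMetric g)

include hg

theorem nondegenerate_metricAt (x : M) : (metricAt g x).Nondegenerate := hg.nondegenerate x

theorem isSymm_metricAt (x : M) : (metricAt g x).IsSymm := hg.symm x

theorem contDiffOn_localMetric (x : M) :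
    ContDiffOn ℝ ∞ (localMetric g x) (extChartAt 𝓘(ℝ, E) x).target := by
  rw [contDiffOn_clm_apply]
  intro v
  rw [contDiffOn_clm_apply]
  intro w
  exact hg.smooth x v w

theorem contDiffAt_localMetric (x : M) {e : E} (he : e ∈ (extChartAt 𝓘(ℝ, E) x).target)
    {n : ℕ∞} : ContDiffAt ℝ n (localMetric g x) e :=
  ((contDiffOn_localMetric hg x).contDiffAt ((isOpen_extChartAt_target x).mem_nhds he)).of_le
    (by exact_mod_cast le_top)

theorem localMetric_symm (x : M) (e v w : E) : localMetric g x e v w = localMetric g x e w v :=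
  (hg.symm _).eq _ _

theorem localMetric_injective (x : M) {e : E} (he : e ∈ (extChartAt 𝓘(ℝ, E) x).target) :
    Function.Injective (localMetric g x e) := by
  rw [injective_iff_map_eq_zero]
  intro v hv
  have h : frame x e v = 0 := by
    refine (nondegenerate_metricAt hg ((extChartAt 𝓘(ℝ, E) x).symm e)).1 (frame x e v) fun w => ?_
    have := congrArg (fun T : E →L[ℝ] ℝ => T (coframe x ((extChartAt 𝓘(ℝ, E) x).symm e) w)) hv
    rwa [localMetric_apply, frame_coframe he] at this
  rw [← coframe_frame he v, h, map_zero]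

theorem christoffelFirst_eq (x : M) (X Y Z : E) :
    christoffelFirst g x X Y Z =
      christoffelAt (localMetric g x) (extChartAt 𝓘(ℝ, E) x x) X Y Z := by
  have h : DifferentiableAt ℝ (localMetric g x) (extChartAt 𝓘(ℝ, E) x x) :=
    (contDiffAt_localMetric hg x (mem_extChartAt_target x) (n := 1)).differentiableAt one_ne_zero
  have hd (v w a : E) : fderiv ℝ (metricCoeff g x v w) (extChartAt 𝓘(ℝ, E) x x) a =
      fderiv ℝ (localMetric g x) (extChartAt 𝓘(ℝ, E) x x) a v w := by
    rw [metricCoeff_eq]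
    have := ((h.hasFDerivAt.clm_apply (hasFDerivAt_const v _)).clm_apply
      (hasFDerivAt_const w _)).fderiv
    rw [this]
    simp
  simp only [christoffelFirst, christoffelAt, hd]

theorem apply_christoffel (x : M) (X Y Z : E) :
    metricAt g x (christoffel g x X Y) Z =
      christoffelAt (localMetric g x) (extChartAt 𝓘(ℝ, E) x x) X Y Z := by
  have h : (christoffel g x X Y : E) = sharp (metricAt g x)
      (fun Z => christoffelForm (localMetric g x) (extChartAt 𝓘(ℝ, E) x x) X Y Z) :=
    congrArg (sharp (metricAt g x)) (funext (christoffelFirst_eq hg x X Y))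
  rw [h, apply_sharp (nondegenerate_metricAt hg x)]
  rfl

end Charts

section Product

variable {E : Type*} [NormedAddCommGroup E] [NormedSpace ℝ E] [FiniteDimensional ℝ E]
  {M : Type*} [TopologicalSpace M] [ChartedSpace E M] [IsManifold 𝓘(ℝ, E) ∞ M]

/-- The scalar product `γ + ε dt²` on the product of a vector space with a line. -/
def prodForm {V : Type*} [AddCommGroup V] [Module ℝ V] (γ : LinearMap.BilinForm ℝ V) (ε : ℝ) :
    LinearMap.BilinForm ℝ (V × ℝ) :=
  LinearMap.BilinForm.comp γ (LinearMap.fst ℝ V ℝ) (LinearMap.fst ℝ V ℝ) +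
    ε • LinearMap.BilinForm.comp (LinearMap.mul ℝ ℝ) (LinearMap.snd ℝ V ℝ) (LinearMap.snd ℝ V ℝ)

theorem prodForm_apply {V : Type*} [AddCommGroup V] [Module ℝ V] (γ : LinearMap.BilinForm ℝ V)
    (ε : ℝ) (v w : V × ℝ) : prodForm γ ε v w = γ v.1 w.1 + ε * (v.2 * w.2) := rfl

theorem nondegenerate_prodForm {V : Type*} [AddCommGroup V] [Module ℝ V]
    {γ : LinearMap.BilinForm ℝ V} (hγ : γ.Nondegenerate) (hs : γ.IsSymm) {ε : ℝ} (hε : ε ≠ 0) :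
    (prodForm γ ε).Nondegenerate := by
  have h : ∀ v, (∀ w, prodForm γ ε v w = 0) → v = 0 := by
    intro v hv
    have h₁ : v.1 = 0 := hγ.1 v.1 fun w => by simpa [prodForm_apply] using hv (w, 0)
    have h₂ : v.2 = 0 := by simpa [prodForm_apply, hε] using hv (0, 1)
    exact Prod.ext h₁ h₂
  refine ⟨h, fun v hv => h v fun w => ?_⟩
  rw [← hv w, prodForm_apply, prodForm_apply, mul_comm v.2, ← hs.eq]

theorem mfderiv_extChartAt_prod_symm (q : M × ℝ) {e : E × ℝ}
    (he : e.1 ∈ (extChartAt 𝓘(ℝ, E) q.1).target) :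
    mfderiv 𝓘(ℝ, E × ℝ) (𝓘(ℝ, E).prod 𝓘(ℝ, ℝ)) (extChartAt (𝓘(ℝ, E).prod 𝓘(ℝ, ℝ)) q).symm e =
      (frame q.1 e.1).prodMap (ContinuousLinearMap.id ℝ ℝ) := by
  have h := (mdifferentiableAt_extChartAt_symm he).hasMFDerivAt.prodMap
    (p := e) (g := (id : ℝ → ℝ)) (hasMFDerivAt_id (I := 𝓘(ℝ, ℝ)) e.2)
  have h2 := h.mfderiv
  rw [modelWithCornersSelf_prod, ← chartedSpaceSelf_prod]
  rw [mfderiv_id] at h2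
  rw [extChartAt_prod]
  exact h2

theorem metricCoeff_prodMetric (g : BilinField 𝓘(ℝ, E) M) (ε : ℝ) (q : M × ℝ) (v w : E × ℝ)
    {e : E × ℝ} (he : e.1 ∈ (extChartAt 𝓘(ℝ, E) q.1).target) :
    metricCoeff (prodMetric g ε) q v w e =
      localMetric g q.1 e.1 v.1 w.1 + ε * (v.2 * w.2) := by
  rw [metricCoeff, mfderiv_extChartAt_prod_symm q he, extChartAt_prod]
  rfl

variable {g : BilinField 𝓘(ℝ, E) M} (hg : IsSemiRiemannianMetric g) {ε : ℝ}

include hg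

theorem christoffelFirst_prodMetric (q : M × ℝ) (X Y Z : E × ℝ) :
    christoffelFirst (prodMetric g ε) q X Y Z =
      christoffelAt (localMetric g q.1) (extChartAt 𝓘(ℝ, E) q.1 q.1) X.1 Y.1 Z.1 := by
  have h : DifferentiableAt ℝ (localMetric g q.1) (extChartAt 𝓘(ℝ, E) q.1 q.1) :=
    (contDiffAt_localMetric hg q.1 (mem_extChartAt_target q.1) (n := 1)).differentiableAt
      one_ne_zero
  have hd (v w a : E × ℝ) : fderiv ℝ (metricCoeff (prodMetric g ε) q v w)
      (extChartAt (𝓘(ℝ, E).prod 𝓘(ℝ, ℝ)) q q) a =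
      fderiv ℝ (localMetric g q.1) (extChartAt 𝓘(ℝ, E) q.1 q.1) a.1 v.1 w.1 := by
    set e₀ : E × ℝ := (extChartAt 𝓘(ℝ, E) q.1 q.1, q.2) with he₀
    have hq : extChartAt (𝓘(ℝ, E).prod 𝓘(ℝ, ℝ)) q q = e₀ := by
      rw [extChartAt_prod]
      rfl
    have hev : metricCoeff (prodMetric g ε) q v w =ᶠ[𝓝 e₀]
        fun e => localMetric g q.1 e.1 v.1 w.1 + ε * (v.2 * w.2) := by
      filter_upwards [continuousAt_fst.preimage_mem_nhds
        (extChartAt_target_mem_nhds (I := 𝓘(ℝ, E)) q.1)] with e he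
      exact metricCoeff_prodMetric g ε q v w he
    have h1 : HasFDerivAt (fun e : E × ℝ => localMetric g q.1 e.1)
        ((fderiv ℝ (localMetric g q.1) e₀.1).comp (ContinuousLinearMap.fst ℝ E ℝ)) e₀ :=
      HasFDerivAt.comp (𝕜 := ℝ) (E := E × ℝ) (F := E) (G := E →L[ℝ] E →L[ℝ] ℝ)
        (f := Prod.fst) (g := localMetric g q.1) (f' := ContinuousLinearMap.fst ℝ E ℝ)
        (g' := fderiv ℝ (localMetric g q.1) e₀.1) e₀ h.hasFDerivAt hasFDerivAt_fst
    have h2 := ((h1.clm_apply (hasFDerivAt_const v.1 _)).clm_apply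
      (hasFDerivAt_const w.1 _)).add_const (ε * (v.2 * w.2))
    rw [hq, (h2.congr_of_eventuallyEq hev).fderiv]
    simp
    rfl
  simp only [christoffelFirst, christoffelAt, hd]

/-- The Christoffel symbol of the product metric, with the tangent spaces identified with the model
space. -/
noncomputable def prodChristoffel (g : BilinField 𝓘(ℝ, E) M) (ε : ℝ) (q : M × ℝ) (X Y : E × ℝ) :
    E × ℝ := christoffel (prodMetric g ε) q X Y

theorem apply_prodChristoffel (hε : ε ≠ 0) (q : M × ℝ) (X Y Z : E × ℝ) :
    prodForm (metricAt g q.1) ε (prodChristoffel g ε q X Y) Z =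
      christoffelAt (localMetric g q.1) (extChartAt 𝓘(ℝ, E) q.1 q.1) X.1 Y.1 Z.1 := by
  have h : prodChristoffel g ε q X Y = sharp (prodForm (metricAt g q.1) ε)
      (fun Z => ((christoffelForm (localMetric g q.1) (extChartAt 𝓘(ℝ, E) q.1 q.1) X.1 Y.1).comp
        (LinearMap.fst ℝ E ℝ)) Z) :=
    congrArg (sharp (prodForm (metricAt g q.1) ε)) (funext (christoffelFirst_prodMetric hg q X Y))
  rw [h, apply_sharp (nondegenerate_prodForm (nondegenerate_metricAt hg q.1)
    (isSymm_metricAt hg q.1) hε)]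
  rfl

end Product

/-! ### Mean curvature of graphs -/

section GraphLinear

variable {V : Type*} [AddCommGroup V] [Module ℝ V] {γ : LinearMap.BilinForm ℝ V} {ε : ℝ}
  {α : V →ₗ[ℝ] ℝ} {ν : V × ℝ}

/-- The restriction of `γ + ε dt²` to the graph of the linear form `α`. -/
def graphForm (γ : LinearMap.BilinForm ℝ V) (ε : ℝ) (α : V →ₗ[ℝ] ℝ) : LinearMap.BilinForm ℝ V :=
  LinearMap.BilinForm.comp (prodForm γ ε) (LinearMap.id.prod α) (LinearMap.id.prod α)

theorem graphForm_apply (v w : V) :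
    graphForm γ ε α v w = γ v w + ε * (α v * α w) := rfl

theorem graphForm_eq_prodForm (v w : V) :
    graphForm γ ε α v w = prodForm γ ε (v, α v) (w, α w) := rfl

theorem prodForm_comm (hs : γ.IsSymm) (v w : V × ℝ) : prodForm γ ε v w = prodForm γ ε w v := by
  rw [prodForm_apply, prodForm_apply, mul_comm v.2]
  exact congrArg (· + _) (hs.eq _ _)

/-- A vector orthogonal to the graph of `α` is a multiple of the normal `ν`. -/
theorem smul_eq_smul_normal (hγ : γ.Nondegenerate)
    (hν : ∀ w, prodForm γ ε ν (w, α w) = 0) (hνν : prodForm γ ε ν ν ≠ 0) {n : V × ℝ}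
    (hn : ∀ w, prodForm γ ε n (w, α w) = 0) :
    prodForm γ ε ν ν • n = prodForm γ ε n ν • ν := by
  set m := prodForm γ ε ν ν • n - prodForm γ ε n ν • ν with hm
  have h₁ (w : V) : prodForm γ ε m (w, α w) = 0 := by simp [hm, hn, hν]
  have h₂ : prodForm γ ε m ν = 0 := by
    simp [hm]
    ring
  have hm₂ : m.2 = 0 := by
    have e₁ := h₁ ν.1
    have e₂ := hν ν.1
    rw [prodForm_apply] at h₂ hνν e₁ e₂
    -- The product below is the value of `⟨ν, ν⟩`, so that `ν` is transversal to the graph of `α`.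
    have e₃ : ε * ν.2 * (ν.2 - α ν.1) ≠ 0 := fun h => hνν (by simp at e₂ ⊢; linarith)
    have e₄ : ε * m.2 * (ν.2 - α ν.1) = 0 := by simp only at e₁; linarith
    rcases mul_eq_zero.1 e₄ with h | h
    · rcases mul_eq_zero.1 h with h | h
      · exact absurd (by rw [h]; ring) e₃
      · exact h
    · exact absurd (by rw [h]; ring) e₃
  have hm₁ : m.1 = 0 := hγ.1 _ fun w => by simpa [prodForm_apply, hm₂] using h₁ w
  have : m = 0 := Prod.ext hm₁ hm₂
  exact sub_eq_zero.1 this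

theorem nondegenerate_graphForm (hγ : γ.Nondegenerate) (hs : γ.IsSymm)
    (hν : ∀ w, prodForm γ ε ν (w, α w) = 0) (hνν : prodForm γ ε ν ν ≠ 0) :
    (graphForm γ ε α).Nondegenerate := by
  have h : ∀ v, (∀ w, graphForm γ ε α v w = 0) → v = 0 := by
    intro v hv
    have h₁ := smul_eq_smul_normal hγ hν hνν (n := (v, α v)) hv
    rw [prodForm_comm hs (v, α v), hν, zero_smul] at h₁
    exact congrArg Prod.fst ((smul_eq_zero.1 h₁).resolve_left hνν)
  refine ⟨h, fun v hv => h v fun w => ?_⟩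
  rw [graphForm_eq_prodForm, prodForm_comm hs]
  exact hv w

variable [FiniteDimensional ℝ V]

/-- The component of a vector normal to the graph of `α`. -/
noncomputable def graphNormalPart (γ : LinearMap.BilinForm ℝ V) (ε : ℝ) (α : V →ₗ[ℝ] ℝ)
    (v : V × ℝ) : V × ℝ :=
  v - metricTrace (graphForm γ ε α)
    (fun X Y => prodForm γ ε v (X, α X) • ((Y, α Y) : V × ℝ))

theorem graphNormalPart_orthogonal (hγ : (graphForm γ ε α).Nondegenerate) (v : V × ℝ) (w : V) :
    prodForm γ ε (graphNormalPart γ ε α v) (w, α w) = 0 := by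
  set β : V →ₗ[ℝ] ℝ := (prodForm γ ε v).comp (LinearMap.id.prod α)
  have h₁ : metricTrace (graphForm γ ε α)
      (fun X Y => prodForm γ ε v (X, α X) • ((Y, α Y) : V × ℝ)) =
      (LinearMap.id.prod α) (sharp (graphForm γ ε α) (fun X => β X)) := by
    rw [sharp, map_metricTrace]
    simp only [map_smul]
    rfl
  have h₂ := apply_sharp hγ β w
  rw [graphNormalPart, map_sub, LinearMap.sub_apply, h₁]
  exact sub_eq_zero.2 h₂.symm

theorem graphNormalPart_apply_normal (hs : γ.IsSymm) (hν : ∀ w, prodForm γ ε ν (w, α w) = 0)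
    (v : V × ℝ) : prodForm γ ε (graphNormalPart γ ε α v) ν = prodForm γ ε v ν := by
  have h (w : V) : prodForm γ ε (w, α w) ν = 0 := by rw [prodForm_comm hs, hν]
  rw [graphNormalPart, map_sub, LinearMap.sub_apply, sub_eq_self]
  simp only [bilinForm_metricTrace, map_smul, LinearMap.smul_apply, h, smul_zero]
  exact metricTrace_zero _

end GraphLinear

section Function

variable {E : Type*} [NormedAddCommGroup E] [NormedSpace ℝ E] [FiniteDimensional ℝ E]
  {M : Type*} [TopologicalSpace M] [ChartedSpace E M] [IsManifold 𝓘(ℝ, E) ∞ M]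

/-- The differential of `u` at `x`, as a linear form on the model space. -/
noncomputable def differential (u : M → ℝ) (x : M) : E →L[ℝ] ℝ := mfderiv 𝓘(ℝ, E) 𝓘(ℝ, ℝ) u x

variable {u : M → ℝ} (hu : ContMDiff 𝓘(ℝ, E) 𝓘(ℝ, ℝ) 2 u)

include hu

theorem contDiffAt_comp_extChartAt_symm (x : M) {e : E}
    (he : e ∈ (extChartAt 𝓘(ℝ, E) x).target) :
    ContDiffAt ℝ 2 (u ∘ (extChartAt 𝓘(ℝ, E) x).symm) e := by
  have : IsManifold 𝓘(ℝ, E) 2 M := IsManifold.of_le (n := ∞) 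
    (WithTop.coe_le_coe.2 (le_top : (2 : ℕ∞) ≤ ⊤))
  have h := (contMDiffOn_extChartAt_symm (I := 𝓘(ℝ, E)) (n := 2) x).contMDiffAt
    ((isOpen_extChartAt_target x).mem_nhds he)
  exact contMDiffAt_iff_contDiffAt.1 (hu.contMDiffAt.comp e h)

theorem differential_frame (x : M) {e : E} (he : e ∈ (extChartAt 𝓘(ℝ, E) x).target) (v : E) :
    differential u ((extChartAt 𝓘(ℝ, E) x).symm e) (frame x e v) =
      fderiv ℝ (u ∘ (extChartAt 𝓘(ℝ, E) x).symm) e v := by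
  have h := mfderiv_comp e (hu.mdifferentiableAt two_ne_zero (x := (extChartAt 𝓘(ℝ, E) x).symm e))
    (mdifferentiableAt_extChartAt_symm he)
  rw [mfderiv_eq_fderiv] at h
  exact (congrArg (fun T : E →L[ℝ] ℝ => T v) h).symm

theorem differential_eq_fderiv (x : M) (v : E) :
    differential u x v =
      fderiv ℝ (u ∘ (extChartAt 𝓘(ℝ, E) x).symm) (extChartAt 𝓘(ℝ, E) x x) v := by
  rw [← differential_frame hu x (mem_extChartAt_target x), frame_self, extChartAt_to_inv]
  rfl

theorem mfderiv_graphMap (x : M) (v : E) :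
    (mfderiv 𝓘(ℝ, E) (𝓘(ℝ, E).prod 𝓘(ℝ, ℝ)) (graphMap u) x v : E × ℝ) =
      (v, differential u x v) := by
  have h := ((hasMFDerivAt_id (I := 𝓘(ℝ, E)) x).prodMk
    (hu.mdifferentiableAt two_ne_zero (x := x)).hasMFDerivAt).mfderiv
  exact congrArg (fun T : E →L[ℝ] E × ℝ => T v) h

theorem fderiv_fderiv_graphMap (x : M) (X Y : E) :
    fderiv ℝ (fderiv ℝ (writtenInExtChartAt 𝓘(ℝ, E) (𝓘(ℝ, E).prod 𝓘(ℝ, ℝ)) x (graphMap u)))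
      (extChartAt 𝓘(ℝ, E) x x) X Y =
      (0, fderiv ℝ (fderiv ℝ (u ∘ (extChartAt 𝓘(ℝ, E) x).symm)) (extChartAt 𝓘(ℝ, E) x x) X Y) := by
  set e₀ := extChartAt 𝓘(ℝ, E) x x
  set w := u ∘ (extChartAt 𝓘(ℝ, E) x).symm
  have h₁ : writtenInExtChartAt 𝓘(ℝ, E) (𝓘(ℝ, E).prod 𝓘(ℝ, ℝ)) x (graphMap u) =ᶠ[𝓝 e₀]
      fun e => (e, w e) := by
    filter_upwards [extChartAt_target_mem_nhds (I := 𝓘(ℝ, E)) x] with e he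
    rw [writtenInExtChartAt, extChartAt_prod]
    exact Prod.ext ((extChartAt 𝓘(ℝ, E) x).right_inv he) rfl
  have hw : ∀ᶠ e in 𝓝 e₀, DifferentiableAt ℝ w e := by
    filter_upwards [extChartAt_target_mem_nhds (I := 𝓘(ℝ, E)) x] with e he
    exact (contDiffAt_comp_extChartAt_symm hu x he).differentiableAt two_ne_zero
  have h₂ : fderiv ℝ (fun e => (e, w e)) =ᶠ[𝓝 e₀]
      fun e => (ContinuousLinearMap.id ℝ E).prod (fderiv ℝ w e) := by
    filter_upwards [hw] with e he
    exact ((hasFDerivAt_id e).prodMk he.hasFDerivAt).fderiv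
  have hd : DifferentiableAt ℝ (fderiv ℝ w) e₀ :=
    (((contDiffAt_comp_extChartAt_symm hu x (mem_extChartAt_target x)).fderiv_right (m := 1)
      (by norm_num)).differentiableAt one_ne_zero)
  have h₃ : HasFDerivAt (fun e => (ContinuousLinearMap.id ℝ E).prod (fderiv ℝ w e))
      ((ContinuousLinearMap.compL ℝ E ℝ (E × ℝ) (ContinuousLinearMap.inr ℝ E ℝ)).comp
        (fderiv ℝ (fderiv ℝ w) e₀)) e₀ := by
    have e₁ : (fun e => (ContinuousLinearMap.id ℝ E).prod (fderiv ℝ w e)) =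
        fun e => ContinuousLinearMap.compL ℝ E ℝ (E × ℝ) (ContinuousLinearMap.inr ℝ E ℝ)
          (fderiv ℝ w e) + ContinuousLinearMap.inl ℝ E ℝ := by
      ext e v <;> simp
    rw [e₁]
    exact ((ContinuousLinearMap.hasFDerivAt _).comp e₀ hd.hasFDerivAt).add_const _
  rw [(h₁.fderiv.trans h₂).fderiv_eq, h₃.fderiv]
  simp

end Function

section Graph

variable {E : Type*} [NormedAddCommGroup E] [NormedSpace ℝ E] [FiniteDimensional ℝ E]
  {M : Type*} [TopologicalSpace M] [ChartedSpace E M] [IsManifold 𝓘(ℝ, E) ∞ M]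
  {g : BilinField 𝓘(ℝ, E) M} (hg : IsSemiRiemannianMetric g) {ε : ℝ} (hε : ε ≠ 0)
  {u : M → ℝ} (hu : ContMDiff 𝓘(ℝ, E) 𝓘(ℝ, ℝ) 2 u)
  {ν : (x : M) → TangentSpace (𝓘(ℝ, E).prod 𝓘(ℝ, ℝ)) (graphMap u x)}
  (hν : IsUnitUpwardNormal g ε u ν)

/-- A vector field along the graph of `u`, with the tangent spaces identified with the model
space. -/
def normalAt {u : M → ℝ}
    (ν : (x : M) → TangentSpace (𝓘(ℝ, E).prod 𝓘(ℝ, ℝ)) (graphMap u x)) (x : M) : E × ℝ := ν x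

/-- The mean curvature of the graph of `u` with respect to the normal `ν = (a, b)`: the trace of
`⟨II, ν⟩ = ε b D²u + Γ(·, ·; a)`. -/
noncomputable def graphMeanCurvature (g : BilinField 𝓘(ℝ, E) M) (ε : ℝ) (u : M → ℝ)
    (ν : (x : M) → TangentSpace (𝓘(ℝ, E).prod 𝓘(ℝ, ℝ)) (graphMap u x)) (x : M) : ℝ :=
  metricTrace (graphForm (metricAt g x) ε (differential u x).toLinearMap)
    (fun X Y => hessianForm (localMetric g x) (u ∘ (extChartAt 𝓘(ℝ, E) x).symm)
      (extChartAt 𝓘(ℝ, E) x x) (normalAt ν x).1 (ε * (normalAt ν x).2) X Y)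

include hu in
theorem inducedMetric_graphMap (g : BilinField 𝓘(ℝ, E) M) (ε : ℝ) (x : M) :
    inducedMetric (I := 𝓘(ℝ, E)) (prodMetric g ε) (graphMap u) x =
      graphForm (metricAt g x) ε (differential u x).toLinearMap := by
  have key (T : E →L[ℝ] E × ℝ) (hT : ∀ v, T v = (v, differential u x v)) :
      LinearMap.BilinForm.comp (prodForm (metricAt g x) ε) T.toLinearMap T.toLinearMap =
        graphForm (metricAt g x) ε (differential u x).toLinearMap := by
    have : T.toLinearMap = LinearMap.id.prod (differential u x).toLinearMap := LinearMap.ext hT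
    rw [this]
    rfl
  exact key _ (mfderiv_graphMap hu x)

include hu in
theorem normalPart_graphMap (g : BilinField 𝓘(ℝ, E) M) (ε : ℝ) (x : M) (v : E × ℝ) :
    (normalPart 𝓘(ℝ, E) (prodMetric g ε) (graphMap u) x v : E × ℝ) =
      graphNormalPart (metricAt g x) ε (differential u x).toLinearMap v := by
  have key (γ : LinearMap.BilinForm ℝ E) (T : E →L[ℝ] E × ℝ)
      (hγ : γ = graphForm (metricAt g x) ε (differential u x).toLinearMap)
      (hT : ∀ w, T w = (w, differential u x w)) :
      v - metricTrace γ (fun X Y => prodForm (metricAt g x) ε v (T X) • T Y) =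
        graphNormalPart (metricAt g x) ε (differential u x).toLinearMap v := by
    simp only [hγ, hT]
    rfl
  exact key _ _ (inducedMetric_graphMap hu g ε x) (mfderiv_graphMap hu x)

include hν hu in
theorem prodForm_normalAt (x : M) (w : E) :
    prodForm (metricAt g x) ε (normalAt ν x) (w, (differential u x).toLinearMap w) = 0 :=
  (congrArg (fun z : E × ℝ => prodForm (metricAt g x) ε (normalAt ν x) z)
    (mfderiv_graphMap hu x w)).symm.trans (hν.orthogonal x w)

include hν in
theorem prodForm_normalAt_self (x : M) :
    prodForm (metricAt g x) ε (normalAt ν x) (normalAt ν x) = 1 ∨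
      prodForm (metricAt g x) ε (normalAt ν x) (normalAt ν x) = -1 := hν.unit x

include hν in
theorem prodForm_normalAt_self_ne_zero (x : M) :
    prodForm (metricAt g x) ε (normalAt ν x) (normalAt ν x) ≠ 0 := by
  rcases prodForm_normalAt_self hν x with h | h <;> rw [h] <;> norm_num

include hν in
theorem smul_normalAt_inj (x : M) (a b : ℝ) :
    (prodForm (metricAt g x) ε (normalAt ν x) (normalAt ν x) * a) • normalAt ν x =
      (prodForm (metricAt g x) ε (normalAt ν x) (normalAt ν x) * b) • normalAt ν x ↔ a = b := by
  have h : normalAt ν x ≠ 0 := fun h => (hν.upward x).ne' (congrArg Prod.snd h)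
  rw [smul_left_inj h, mul_right_inj' (prodForm_normalAt_self_ne_zero hν x)]

include hg hu hν

theorem nondegenerate_graphForm_differential (x : M) :
    (graphForm (metricAt g x) ε (differential u x).toLinearMap).Nondegenerate :=
  nondegenerate_graphForm (nondegenerate_metricAt hg x) (isSymm_metricAt hg x)
    (prodForm_normalAt hu hν x) (prodForm_normalAt_self_ne_zero hν x)

/-- The unit normal spans the normal space of the graph. -/
theorem eq_smul_normalAt (x : M) {n : E × ℝ}
    (hn : ∀ w, prodForm (metricAt g x) ε n (w, (differential u x).toLinearMap w) = 0) :
    n = (prodForm (metricAt g x) ε (normalAt ν x) (normalAt ν x) *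
      prodForm (metricAt g x) ε n (normalAt ν x)) • normalAt ν x := by
  have h := smul_eq_smul_normal (nondegenerate_metricAt hg x)
    (prodForm_normalAt hu hν x) (prodForm_normalAt_self_ne_zero hν x) hn
  rw [mul_smul, ← h, smul_smul]
  rcases prodForm_normalAt_self hν x with h | h <;> rw [h] <;> simp

theorem partialTPerp_eq (x : M) :
    (partialTPerp g ε u x : E × ℝ) =
      (prodForm (metricAt g x) ε (normalAt ν x) (normalAt ν x) * (ε * (normalAt ν x).2)) •
        normalAt ν x := by
  have h : (partialTPerp g ε u x : E × ℝ) = _ := normalPart_graphMap hu g ε x (0, 1)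
  rw [h, eq_smul_normalAt hg hu hν x (n := graphNormalPart _ _ _ _)
      (graphNormalPart_orthogonal (nondegenerate_graphForm_differential hg hu hν x) _),
    graphNormalPart_apply_normal (isSymm_metricAt hg x) (prodForm_normalAt hu hν x)]
  have h₁ : prodForm (metricAt g x) ε (0, 1) (normalAt ν x) = ε * (normalAt ν x).2 := by
    rw [prodForm_apply]
    simp
  rw [h₁]

include hε

theorem meanCurvatureVector_eq (x : M) :
    (meanCurvatureVector 𝓘(ℝ, E) (prodMetric g ε) (graphMap u) x : E × ℝ) =
      (prodForm (metricAt g x) ε (normalAt ν x) (normalAt ν x) * graphMeanCurvature g ε u ν x) •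
        normalAt ν x := by
  set γ := graphForm (metricAt g x) ε (differential u x).toLinearMap
  set II : E → E → E × ℝ := fun X Y => graphNormalPart (metricAt g x) ε
    (differential u x).toLinearMap ((0, fderiv ℝ (fderiv ℝ (u ∘ (extChartAt 𝓘(ℝ, E) x).symm))
      (extChartAt 𝓘(ℝ, E) x x) X Y) + prodChristoffel g ε (graphMap u x)
        (X, differential u x X) (Y, differential u x Y)) with hII
  have h₁ : (secondFundamentalForm (I := 𝓘(ℝ, E)) (prodMetric g ε) (graphMap u) x :
      E → E → E × ℝ) = II := by
    funext X Y
    refine (normalPart_graphMap hu g ε x _).trans ?_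
    refine congrArg (graphNormalPart (metricAt g x) ε (differential u x).toLinearMap) ?_
    refine congrArg₂ (fun a b : E × ℝ => a + b) (fderiv_fderiv_graphMap hu x X Y) ?_
    exact congrArg₂ (prodChristoffel g ε (graphMap u x))
      (mfderiv_graphMap hu x X) (mfderiv_graphMap hu x Y)
  have h₂ : (meanCurvatureVector 𝓘(ℝ, E) (prodMetric g ε) (graphMap u) x : E × ℝ) =
      metricTrace γ II :=
    congrArg₂ (fun (γ : LinearMap.BilinForm ℝ E) (b : E → E → E × ℝ) => metricTrace γ b)
      (inducedMetric_graphMap hu g ε x) h₁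
  have h₃ (w : E) : prodForm (metricAt g x) ε (metricTrace γ II)
      (w, (differential u x).toLinearMap w) = 0 := by
    simp only [bilinForm_metricTrace, hII, graphNormalPart_orthogonal
      (nondegenerate_graphForm_differential hg hu hν x)]
    exact metricTrace_zero _
  have h₄ : prodForm (metricAt g x) ε (metricTrace γ II) (normalAt ν x) =
      graphMeanCurvature g ε u ν x := by
    rw [bilinForm_metricTrace, graphMeanCurvature]
    refine congrArg (metricTrace γ) ?_
    funext X Y
    simp only [hII]
    rw [graphNormalPart_apply_normal (isSymm_metricAt hg x) (prodForm_normalAt hu hν x),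
      map_add, LinearMap.add_apply, hessianForm_apply]
    refine congrArg₂ (· + ·) ?_ (apply_prodChristoffel hg hε (graphMap u x) _ _ _)
    rw [prodForm_apply]
    simp
    ring
  rw [h₂, eq_smul_normalAt hg hu hν x h₃, h₄]

end Graph

/-! ### Linear algebra of horizontal lifts -/

section Lift

variable {V W : Type*} [AddCommGroup V] [Module ℝ V] [FiniteDimensional ℝ V]
  [AddCommGroup W] [Module ℝ W] [FiniteDimensional ℝ W]
  {γ : LinearMap.BilinForm ℝ V} {γ' : LinearMap.BilinForm ℝ W} {T : V →ₗ[ℝ] W}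

/-- Horizontal lifts: a surjective linear map with nondegenerate kernel has a right inverse with
values in the orthogonal complement of the kernel. -/
theorem exists_horizontal_section (hs : γ.IsSymm) (hT : Function.Surjective T)
    (hker : (γ.restrict (LinearMap.ker T)).Nondegenerate) :
    ∃ s : W →ₗ[ℝ] V, (∀ w, T (s w) = w) ∧ ∀ w, ∀ v, T v = 0 → γ (s w) v = 0 := by
  have hc := LinearMap.BilinForm.isCompl_orthogonal_of_restrict_nondegenerate hs.isRefl hker
  obtain ⟨r, hr⟩ := T.exists_rightInverse_of_surjective (LinearMap.range_eq_top.2 hT)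
  set p := (LinearMap.ker T).projectionOnto (γ.orthogonal (LinearMap.ker T)) hc
  refine ⟨r - (LinearMap.ker T).subtype.comp (p.comp r), fun w => ?_, fun w v hv => ?_⟩
  · have h₁ : T (r w) = w := congrArg (fun f : W →ₗ[ℝ] W => f w) hr
    have h₂ : T (p (r w) : V) = 0 := (p (r w)).2
    simp [h₁, h₂]
  · have h : r w - (p (r w) : V) ∈ γ.orthogonal (LinearMap.ker T) := by
      rw [← Submodule.projectionOnto_apply_eq_zero_iff hc, map_sub,
        Submodule.projectionOnto_apply_left, sub_self]
    have := h v hv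
    simp only [LinearMap.sub_apply, LinearMap.comp_apply, Submodule.subtype_apply]
    rw [← hs.eq]
    exact this

/-- A linear map that preserves scalar products of horizontal vectors preserves the scalar product
of a horizontal vector with any vector. -/
theorem apply_horizontal (hs : γ.IsSymm) (hT : Function.Surjective T)
    (hker : (γ.restrict (LinearMap.ker T)).Nondegenerate)
    (hiso : ∀ X Y, (∀ v, T v = 0 → γ X v = 0) → (∀ v, T v = 0 → γ Y v = 0) →
      γ' (T X) (T Y) = γ X Y) {X : V} (hX : ∀ v, T v = 0 → γ X v = 0) (w : V) :
    γ' (T X) (T w) = γ X w := by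
  obtain ⟨s, hs₁, hs₂⟩ := exists_horizontal_section hs hT hker
  have h₁ := hiso X (s (T w)) hX (hs₂ (T w))
  have h₂ := hX (w - s (T w)) (by rw [map_sub, hs₁, sub_self])
  rw [hs₁] at h₁
  rw [h₁, eq_comm, ← sub_eq_zero, ← map_sub, h₂]

/-- The unit upward normals of a graph and of its lift are related: the component of the latter in
`V` is the horizontal lift of the component of the former in `W`, and the components along the line
agree, because both normals are unit vectors and point upwards. -/
theorem normal_lift {ε : ℝ} (hγ : γ.Nondegenerate) (hs : γ.IsSymm)
    (hT : Function.Surjective T) (hker : (γ.restrict (LinearMap.ker T)).Nondegenerate)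
    (hiso : ∀ X, (∀ v, T v = 0 → γ X v = 0) → ∀ w, γ' (T X) (T w) = γ X w)
    {α : W →ₗ[ℝ] ℝ} {ν : V × ℝ} {ν' : W × ℝ}
    (hν : ∀ v, prodForm γ ε ν (v, α (T v)) = 0) (hν' : ∀ w, prodForm γ' ε ν' (w, α w) = 0)
    (h₁ : prodForm γ ε ν ν = 1 ∨ prodForm γ ε ν ν = -1)
    (h₁' : prodForm γ' ε ν' ν' = 1 ∨ prodForm γ' ε ν' ν' = -1)
    (hpos : 0 < ν.2) (hpos' : 0 < ν'.2) : T ν.1 = ν'.1 ∧ ν.2 = ν'.2 := by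
  obtain ⟨s, hs₁, hs₂⟩ := exists_horizontal_section hs hT hker
  have hlift (w : V) : γ (s ν'.1) w = γ' ν'.1 (T w) := by
    rw [← hiso _ (hs₂ ν'.1), hs₁]
  -- Both sides represent the same multiple of the form `α ∘ T`.
  have heq : ν'.2 • ν.1 = ν.2 • s ν'.1 := by
    rw [← sub_eq_zero]
    refine hγ.1 _ fun w => ?_
    have e₁ := hν w
    have e₂ := hν' (T w)
    rw [prodForm_apply] at e₁ e₂
    simp only [map_sub, map_smul, LinearMap.sub_apply, LinearMap.smul_apply, smul_eq_mul, hlift]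
    simp only at e₁ e₂
    linear_combination ν'.2 * e₁ - ν.2 * e₂
  -- Comparing lengths in the previous identity.
  have hsq : ν'.2 ^ 2 * prodForm γ ε ν ν = ν.2 ^ 2 * prodForm γ' ε ν' ν' := by
    have e₁ : ν'.2 ^ 2 * γ ν.1 ν.1 = ν.2 ^ 2 * γ (s ν'.1) (s ν'.1) := by
      have := congrArg (fun z => γ z z) heq
      simp only [map_smul, LinearMap.smul_apply, smul_eq_mul] at this
      linear_combination this
    rw [hlift, hs₁] at e₁
    rw [prodForm_apply, prodForm_apply]
    linear_combination e₁
  have hb : ν.2 = ν'.2 := by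
    have p₁ : 0 < ν.2 ^ 2 := by positivity
    have p₂ : 0 < ν'.2 ^ 2 := by positivity
    have : ν.2 ^ 2 = ν'.2 ^ 2 := by
      rcases h₁ with h | h <;> rcases h₁' with h' | h' <;> rw [h, h'] at hsq <;> linarith
    exact (pow_left_inj₀ hpos.le hpos'.le two_ne_zero).1 this
  refine ⟨?_, hb⟩
  rw [hb] at heq
  have := smul_right_injective V hpos'.ne' heq
  rw [this, hs₁]

/-- The contraction with the metric of a lifted graph is the sum of the contractions over the fiber
and over the base. -/
theorem metricTrace_graphForm_lift {ε : ℝ} {α : W →ₗ[ℝ] ℝ} (hs : γ.IsSymm)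
    (hT : Function.Surjective T) (hker : (γ.restrict (LinearMap.ker T)).Nondegenerate)
    (hiso : ∀ X, (∀ v, T v = 0 → γ X v = 0) → ∀ w, γ' (T X) (T w) = γ X w)
    (hnd : (graphForm γ' ε α).Nondegenerate)
    {b : LinearMap.BilinForm ℝ V} {b' : LinearMap.BilinForm ℝ W}
    (hb : ∀ X Y, (∀ v, T v = 0 → γ X v = 0) → (∀ v, T v = 0 → γ Y v = 0) →
      b X Y = b' (T X) (T Y)) :
    metricTrace (graphForm γ ε (α.comp T)) (fun X Y => b X Y) =
      metricTrace (γ.restrict (LinearMap.ker T)) (fun X Y => b X Y) +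
        metricTrace (graphForm γ' ε α) (fun X Y => b' X Y) := by
  obtain ⟨s, hs₁, hs₂⟩ := exists_horizontal_section hs hT hker
  have hk (v : LinearMap.ker T) : T v = 0 := v.2
  let L : (LinearMap.ker T × W) ≃ₗ[ℝ] V :=
    LinearEquiv.ofBijective ((LinearMap.ker T).subtype.coprod s) (by
      constructor
      · rw [← LinearMap.ker_eq_bot, LinearMap.ker_eq_bot']
        rintro ⟨v, w⟩ h
        have h : (v : V) + s w = 0 := h
        have h₁ : w = 0 := by
          have := congrArg T h
          rwa [map_add, hk, hs₁, zero_add, map_zero] at this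
        rw [h₁, map_zero, add_zero] at h
        exact Prod.ext (Subtype.ext h) h₁
      · intro x
        exact ⟨(⟨x - s (T x), by rw [LinearMap.mem_ker, map_sub, hs₁, sub_self]⟩, T x),
          sub_add_cancel x (s (T x))⟩)
  have hL (z : LinearMap.ker T × W) : L z = z.1 + s z.2 := rfl
  have hL₁ (v : LinearMap.ker T) : L (v, 0) = v := by rw [hL, map_zero, add_zero]
  have hL₂ (w : W) : L (0, w) = s w := by rw [hL, Submodule.coe_zero, zero_add]
  refine metricTrace_prod L hker hnd (b₁ := b.restrict (LinearMap.ker T)) ?_ ?_ ?_ ?_ ?_ ?_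
  · intro v w
    rw [hL₁, hL₁, graphForm_apply, LinearMap.comp_apply, hk]
    simp
  · intro v w
    rw [hL₂, hL₂, graphForm_apply, graphForm_apply, ← hiso _ (hs₂ v)]
    simp [hs₁]
  · intro v w
    rw [hL₁, hL₂, graphForm_apply, ← hs.eq]
    simp [hs₂ w v (hk v), hk]
  · intro v w
    rw [hL₁, hL₂, graphForm_apply, hs₂ _ _ (hk w)]
    simp [hk]
  · intro v w
    rw [hL₁, hL₁]
    rfl
  · intro v w
    rw [hL₂, hL₂, hb _ _ (hs₂ v) (hs₂ w), hs₁, hs₁]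

/-- Multiplying by a line does not change contractions over the kernel of a map. -/
theorem metricTrace_restrict_prod {ε : ℝ} {S : Submodule ℝ (V × ℝ)}
    (hS : ∀ z, z ∈ S ↔ T z.1 = 0 ∧ z.2 = 0)
    (hker : (γ.restrict (LinearMap.ker T)).Nondegenerate) (b : LinearMap.BilinForm ℝ V) :
    metricTrace ((prodForm γ ε).restrict S) (fun X Y => b X.1.1 Y.1.1) =
      metricTrace (γ.restrict (LinearMap.ker T)) (fun X Y => b X Y) := by
  let L : LinearMap.ker T ≃ₗ[ℝ] S :=
    { toFun := fun v => ⟨(v, 0), (hS _).2 ⟨v.2, rfl⟩⟩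
      invFun := fun z => ⟨z.1.1, ((hS z.1).1 z.2).1⟩
      map_add' := fun v w => Subtype.ext (by simp)
      map_smul' := fun r v => Subtype.ext (by simp)
      left_inv := fun v => rfl
      right_inv := fun z => Subtype.ext (Prod.ext rfl ((hS z.1).1 z.2).2.symm) }
  refine metricTrace_congr L (b := b.restrict (LinearMap.ker T))
    (b' := (b.comp (LinearMap.fst ℝ V ℝ) (LinearMap.fst ℝ V ℝ)).restrict S) hker ?_ ?_
  · intro v w
    change γ v w + ε * (0 * 0) = γ v w
    simp
  · intro v w
    rfl

end Lift

/-! ### The unit normal and its covariant derivative in charts -/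

section NormalField

variable {E : Type*} [NormedAddCommGroup E] [NormedSpace ℝ E] [FiniteDimensional ℝ E]
  {M : Type*} [TopologicalSpace M] [ChartedSpace E M] [IsManifold 𝓘(ℝ, E) ∞ M]

/-- A vector field in the chart around `x`, as a map of the model space to itself. -/
noncomputable def localField (X : M → E) (x : M) (e : E) : E :=
  coframe x ((extChartAt 𝓘(ℝ, E) x).symm e) (X ((extChartAt 𝓘(ℝ, E) x).symm e))

theorem coframe_self (x : M) (v : E) : coframe x x v = v := by
  have : IsManifold 𝓘(ℝ, E) 1 M := IsManifold.of_le (n := ∞) (by simp)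
  exact congrArg (fun T : E →L[ℝ] E => T v) (mfderiv_extChartAt_self (I := 𝓘(ℝ, E)) (x := x))

theorem localField_self (X : M → E) (x : M) : localField X x (extChartAt 𝓘(ℝ, E) x x) = X x := by
  rw [localField, extChartAt_to_inv, coframe_self]

/-- A vector field is `C^n` if its coordinates are. -/
theorem contMDiff_of_localField [IsManifold 𝓘(ℝ, E) 1 M] {n : WithTop ℕ∞} (hn : n ≤ ∞) {X : M → E}
    (hX : ∀ x, ContDiffAt ℝ n (localField X x) (extChartAt 𝓘(ℝ, E) x x)) :
    ContMDiff 𝓘(ℝ, E) 𝓘(ℝ, E).tangent n (fun x => (⟨x, X x⟩ : TangentBundle 𝓘(ℝ, E) M)) := by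
  intro x
  have : IsManifold 𝓘(ℝ, E) n M := IsManifold.of_le hn
  refine (Bundle.contMDiffAt_section (E := TangentSpace 𝓘(ℝ, E)) x).2 ?_
  have h₁ : ContMDiffAt 𝓘(ℝ, E) 𝓘(ℝ, E) n (localField X x ∘ extChartAt 𝓘(ℝ, E) x) x :=
    (hX x).contMDiffAt.comp x contMDiffAt_extChartAt
  refine h₁.congr_of_eventuallyEq ?_
  filter_upwards [extChartAt_source_mem_nhds (I := 𝓘(ℝ, E)) x] with y hy
  have hy' : y ∈ (chartAt E x).source := by rwa [extChartAt_source] at hy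
  have h₂ := TangentBundle.continuousLinearMapAt_trivializationAt (I := 𝓘(ℝ, E)) hy'
  have h₃ : (coframe x y (X y) : E) = localField X x (extChartAt 𝓘(ℝ, E) x y) := by
    rw [localField, (extChartAt 𝓘(ℝ, E) x).left_inv hy]
  rw [Function.comp_apply, ← h₃]
  have hb : y ∈ (trivializationAt E (TangentSpace 𝓘(ℝ, E)) x).baseSet := hy'
  have h₄ := (trivializationAt E (TangentSpace 𝓘(ℝ, E)) x).continuousLinearMapAt_apply_of_mem
    (R := ℝ) hb (X y)
  exact h₄.symm.trans (congrArg (fun T : E →L[ℝ] E => T (X y)) h₂)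

theorem mfderiv_extChartAt_prod (q : M × ℝ) {y : M × ℝ}
    (hy : y.1 ∈ (extChartAt 𝓘(ℝ, E) q.1).source) :
    mfderiv (𝓘(ℝ, E).prod 𝓘(ℝ, ℝ)) 𝓘(ℝ, E × ℝ) (extChartAt (𝓘(ℝ, E).prod 𝓘(ℝ, ℝ)) q) y =
      (coframe q.1 y.1).prodMap (ContinuousLinearMap.id ℝ ℝ) := by
  have : IsManifold 𝓘(ℝ, E) 1 M := IsManifold.of_le (n := ∞) (by simp)
  have h := ((mdifferentiableAt_extChartAt (I := 𝓘(ℝ, E))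
    (by rwa [extChartAt_source] at hy)).hasMFDerivAt.prodMap
    (p := y) (g := (id : ℝ → ℝ)) (hasMFDerivAt_id (I := 𝓘(ℝ, ℝ)) y.2)).mfderiv
  rw [mfderiv_id] at h
  rw [modelWithCornersSelf_prod, ← chartedSpaceSelf_prod, extChartAt_prod]
  exact h

variable {g : BilinField 𝓘(ℝ, E) M} (hg : IsSemiRiemannianMetric g) {ε : ℝ} (hε : ε ≠ 0)

include hg

theorem apply_covDeriv (X : M → E) (x : M) (U V : E) :
    metricAt g x (covDeriv g X x U) V =
      localMetric g x (extChartAt 𝓘(ℝ, E) x x)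
        (fderiv ℝ (localField X x) (extChartAt 𝓘(ℝ, E) x x) U) V +
      christoffelAt (localMetric g x) (extChartAt 𝓘(ℝ, E) x x) U (X x) V := by
  rw [localMetric_self, ← apply_christoffel hg]
  exact congrArg (fun f : E →ₗ[ℝ] ℝ => f V) (map_add (metricAt g x) _ _)

include hε in
/-- For a field on `M × ℝ` that is invariant under translations of `ℝ`, the covariant derivative in
a direction tangent to `M` has as its component tangent to `M` the covariant derivative of the
component of the field tangent to `M`. -/
theorem apply_covDeriv_prodMetric {Z : M → E × ℝ} (x : M) (t : ℝ)
    (h₁ : DifferentiableAt ℝ (localField (fun y => (Z y).1) x) (extChartAt 𝓘(ℝ, E) x x))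
    (h₂ : DifferentiableAt ℝ (fun e => (Z ((extChartAt 𝓘(ℝ, E) x).symm e)).2)
      (extChartAt 𝓘(ℝ, E) x x)) (U V : E) :
    prodForm (metricAt g x) ε (covDeriv (prodMetric g ε) (fun q => Z q.1) (x, t) ((U, 0) : E × ℝ))
        (V, 0) =
      metricAt g x (covDeriv g (fun y => (Z y).1) x U) V := by
  set φ := extChartAt 𝓘(ℝ, E) x
  set Φ := extChartAt (𝓘(ℝ, E).prod 𝓘(ℝ, ℝ)) ((x, t) : M × ℝ)
  set ζ : E × ℝ → E × ℝ := fun e =>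
    mfderiv (𝓘(ℝ, E).prod 𝓘(ℝ, ℝ)) 𝓘(ℝ, E × ℝ) Φ (Φ.symm e) (Z (Φ.symm e).1) with hζ
  have hΦ : Φ (x, t) = (φ x, t) := by
    simp only [Φ, extChartAt_prod]
    rfl
  have hev : ζ =ᶠ[𝓝 (φ x, t)] fun e =>
      (localField (fun y => (Z y).1) x e.1, (Z (φ.symm e.1)).2) := by
    filter_upwards [(continuousAt_fst (p := (φ x, t))).preimage_mem_nhds
      (extChartAt_target_mem_nhds (I := 𝓘(ℝ, E)) x)] with e he
    have h₃ : Φ.symm e = (φ.symm e.1, e.2) := by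
      simp only [Φ, extChartAt_prod]
      rfl
    have h₄ := mfderiv_extChartAt_prod (E := E) (x, t) (y := (φ.symm e.1, e.2)) (φ.map_target he)
    have h₅ (q : M × ℝ) (hq : q = (φ.symm e.1, e.2)) :
        (mfderiv (𝓘(ℝ, E).prod 𝓘(ℝ, ℝ)) 𝓘(ℝ, E × ℝ) Φ q (Z q.1) : E × ℝ) =
          (localField (fun y => (Z y).1) x e.1, (Z (φ.symm e.1)).2) := by
      subst hq
      exact congrArg (fun T : E × ℝ →L[ℝ] E × ℝ => T (Z (φ.symm e.1))) h₄
    exact h₅ _ h₃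
  have d₁ : HasFDerivAt (fun e : E × ℝ => localField (fun y => (Z y).1) x e.1)
      ((fderiv ℝ (localField (fun y => (Z y).1) x) (φ x)).comp (ContinuousLinearMap.fst ℝ E ℝ))
      (φ x, t) :=
    HasFDerivAt.comp (g := localField (fun y => (Z y).1) x) (f := Prod.fst) (φ x, t)
      h₁.hasFDerivAt hasFDerivAt_fst
  have d₂ : HasFDerivAt (fun e : E × ℝ => (Z (φ.symm e.1)).2)
      ((fderiv ℝ (fun e => (Z (φ.symm e)).2) (φ x)).comp (ContinuousLinearMap.fst ℝ E ℝ))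
      (φ x, t) :=
    HasFDerivAt.comp (g := fun e => (Z (φ.symm e)).2) (f := Prod.fst) (φ x, t)
      h₂.hasFDerivAt hasFDerivAt_fst
  have d₃ : (fderiv ℝ ζ (Φ (x, t)) (U, 0)).1 =
      fderiv ℝ (localField (fun y => (Z y).1) x) (φ x) U := by
    rw [hΦ, hev.fderiv_eq, (d₁.prodMk d₂).fderiv]
    rfl
  have h₆ : (covDeriv (prodMetric g ε) (fun q => Z q.1) (x, t) ((U, 0) : E × ℝ) : E × ℝ) =
      fderiv ℝ ζ (Φ (x, t)) (U, 0) + prodChristoffel g ε (x, t) (U, 0) (Z x) := rfl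
  have h₇ : prodForm (metricAt g x) ε (prodChristoffel g ε (x, t) (U, 0) (Z x)) (V, 0) =
      christoffelAt (localMetric g x) (φ x) U (Z x).1 V :=
    apply_prodChristoffel hg hε (x, t) (U, 0) (Z x) (V, 0)
  rw [h₆, map_add, LinearMap.add_apply, h₇, apply_covDeriv hg (fun y => (Z y).1),
    localMetric_self, prodForm_apply, d₃, mul_zero, mul_zero, add_zero]

variable {u : M → ℝ} (hu : ContMDiff 𝓘(ℝ, E) 𝓘(ℝ, ℝ) 2 u)
  {ν : (x : M) → TangentSpace (𝓘(ℝ, E).prod 𝓘(ℝ, ℝ)) (graphMap u x)}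
  (hν : IsUnitUpwardNormal g ε u ν)

include hu hν

omit hg in
theorem localMetric_normalAt (x : M) {e : E} (he : e ∈ (extChartAt 𝓘(ℝ, E) x).target) (w : E) :
    localMetric g x e (localField (fun y => (normalAt ν y).1) x e) w =
      -(ε * (normalAt ν ((extChartAt 𝓘(ℝ, E) x).symm e)).2) *
        fderiv ℝ (u ∘ (extChartAt 𝓘(ℝ, E) x).symm) e w := by
  have h := prodForm_normalAt hu hν ((extChartAt 𝓘(ℝ, E) x).symm e) (frame x e w)
  rw [prodForm_apply] at h
  rw [localMetric_apply, localField, frame_coframe he, ← differential_frame hu x he]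
  simp only [ContinuousLinearMap.coe_coe] at h
  linarith

theorem contDiffAt_normalAt (x : M) :
    ContDiffAt ℝ 1 (fun e => (normalAt ν ((extChartAt 𝓘(ℝ, E) x).symm e)).2)
        (extChartAt 𝓘(ℝ, E) x x) ∧
      ContDiffAt ℝ 1 (localField (fun y => (normalAt ν y).1) x) (extChartAt 𝓘(ℝ, E) x x) := by
  have hx := mem_extChartAt_target (I := 𝓘(ℝ, E)) x
  refine contDiffAt_unit_normal (ε := ε) (contDiffAt_localMetric hg x hx (n := 1))
    (localMetric_injective hg x hx) (contDiffAt_comp_extChartAt_symm hu x hx) ?_ ?_ ?_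
  · filter_upwards [extChartAt_target_mem_nhds (I := 𝓘(ℝ, E)) x] with e he w
    exact localMetric_normalAt hu hν x he w
  · filter_upwards [extChartAt_target_mem_nhds (I := 𝓘(ℝ, E)) x] with e he
    have h := prodForm_normalAt_self hν ((extChartAt 𝓘(ℝ, E) x).symm e)
    rw [prodForm_apply] at h
    rw [localMetric_apply, localField, frame_coframe he]
    rcases h with h | h <;> rw [h] <;> simp
  · exact Eventually.of_forall fun e => hν.upward _

/-- On vectors tangent to a level set of `u`, the covariant derivative of the tangential component
of the unit normal is given by the Hessian of `u`. -/
theorem apply_covDeriv_normalAt (x : M) (U : E) {V : E} (hV : differential u x V = 0) :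
    metricAt g x (covDeriv g (fun y => (normalAt ν y).1) x U) V =
      -hessianForm (localMetric g x) (u ∘ (extChartAt 𝓘(ℝ, E) x).symm)
        (extChartAt 𝓘(ℝ, E) x x) (normalAt ν x).1 (ε * (normalAt ν x).2) U V := by
  have hx := mem_extChartAt_target (I := 𝓘(ℝ, E)) x
  obtain ⟨h₁, h₂⟩ := contDiffAt_normalAt hg hu hν x
  have h := covariant_derivative_eq_hessian (contDiffAt_localMetric hg x hx (n := 1))
    (h₂.differentiableAt one_ne_zero)
    (β := fun e => -(ε * (normalAt ν ((extChartAt 𝓘(ℝ, E) x).symm e)).2))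
    ((h₁.differentiableAt one_ne_zero).const_mul ε).neg
    (contDiffAt_comp_extChartAt_symm hu x hx)
    (by
      filter_upwards [extChartAt_target_mem_nhds (I := 𝓘(ℝ, E)) x] with e he w
      exact localMetric_normalAt hu hν x he w)
    (Eventually.of_forall fun e v w => localMetric_symm hg x e v w) (U := U) (V := V)
    (by rw [← differential_eq_fderiv hu, hV])
  rw [localField_self (fun y => (normalAt ν y).1), neg_neg, extChartAt_to_inv] at h
  rw [apply_covDeriv hg (fun y => (normalAt ν y).1), h]

end NormalField

/-! ### Graphs lifted along a semi-Riemannian submersion -/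

section Submersion

variable {E : Type*} [NormedAddCommGroup E] [NormedSpace ℝ E] [FiniteDimensional ℝ E]
  {M : Type*} [TopologicalSpace M] [ChartedSpace E M] [IsManifold 𝓘(ℝ, E) ∞ M]
  {F : Type*} [NormedAddCommGroup F] [NormedSpace ℝ F] [FiniteDimensional ℝ F]
  {B : Type*} [TopologicalSpace B] [ChartedSpace F B] [IsManifold 𝓘(ℝ, F) ∞ B]
  {gM : BilinField 𝓘(ℝ, E) M} {gB : BilinField 𝓘(ℝ, F) B} {π : M → B}

/-- The differential of a map between manifolds at `x`, as a linear map of the model spaces. -/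
noncomputable def tangentAt (E F : Type*) [NormedAddCommGroup E] [NormedSpace ℝ E]
    [NormedAddCommGroup F] [NormedSpace ℝ F] {M B : Type*} [TopologicalSpace M]
    [ChartedSpace E M] [TopologicalSpace B] [ChartedSpace F B] (π : M → B) (x : M) : E →L[ℝ] F := mfderiv 𝓘(ℝ, E) 𝓘(ℝ, F) π x

/-- The map `π` in the charts around `x` and `π x`. -/
noncomputable def localMap (E F : Type*) [NormedAddCommGroup E] [NormedSpace ℝ E]
    [NormedAddCommGroup F] [NormedSpace ℝ F] {M B : Type*} [TopologicalSpace M]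
    [ChartedSpace E M] [TopologicalSpace B] [ChartedSpace F B] (π : M → B) (x : M) (e : E) : F :=
  extChartAt 𝓘(ℝ, F) (π x) (π ((extChartAt 𝓘(ℝ, E) x).symm e))

theorem localMap_self (π : M → B) (x : M) :
    localMap E F π x (extChartAt 𝓘(ℝ, E) x x) = extChartAt 𝓘(ℝ, F) (π x) (π x) := by
  rw [localMap, extChartAt_to_inv]

section Smooth

variable (hπ : ContMDiff 𝓘(ℝ, E) 𝓘(ℝ, F) ∞ π)

include hπ

theorem contDiffAt_localMap (x : M) :
    ContDiffAt ℝ 2 (localMap E F π x) (extChartAt 𝓘(ℝ, E) x x) := by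
  have h := (contMDiffAt_iff.1 (hπ x)).2
  rw [ModelWithCorners.range_eq_univ, contDiffWithinAt_univ] at h
  exact h.of_le (WithTop.coe_le_coe.2 (le_top : (2 : ℕ∞) ≤ ⊤))

theorem eventually_mem_source (x : M) : ∀ᶠ e in 𝓝 (extChartAt 𝓘(ℝ, E) x x),
    e ∈ (extChartAt 𝓘(ℝ, E) x).target ∧
      π ((extChartAt 𝓘(ℝ, E) x).symm e) ∈ (extChartAt 𝓘(ℝ, F) (π x)).source := by
  refine Eventually.and (extChartAt_target_mem_nhds (I := 𝓘(ℝ, E)) x) ?_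
  have h : ContinuousAt (fun e => π ((extChartAt 𝓘(ℝ, E) x).symm e)) (extChartAt 𝓘(ℝ, E) x x) := by
    refine ContinuousAt.comp (g := π) ?_ (continuousAt_extChartAt_symm x)
    exact hπ.continuous.continuousAt
  refine h.preimage_mem_nhds ?_
  rw [extChartAt_to_inv]
  exact extChartAt_source_mem_nhds (π x)

theorem fderiv_localMap (x : M) {e : E} (he : e ∈ (extChartAt 𝓘(ℝ, E) x).target)
    (he' : π ((extChartAt 𝓘(ℝ, E) x).symm e) ∈ (extChartAt 𝓘(ℝ, F) (π x)).source) (v : E) :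
    fderiv ℝ (localMap E F π x) e v =
      coframe (π x) (π ((extChartAt 𝓘(ℝ, E) x).symm e))
        (tangentAt E F π ((extChartAt 𝓘(ℝ, E) x).symm e) (frame x e v)) := by
  have : IsManifold 𝓘(ℝ, F) 1 B := IsManifold.of_le (n := ∞) (by simp)
  have h₁ : HasMFDerivAt 𝓘(ℝ, E) 𝓘(ℝ, F) (localMap E F π x) e _ :=
    ((mdifferentiableAt_extChartAt (I := 𝓘(ℝ, F)) (x := π x)
      (by rwa [extChartAt_source] at he')).hasMFDerivAt.comp e
      ((hπ.mdifferentiableAt (by simp) (x := (extChartAt 𝓘(ℝ, E) x).symm e)).hasMFDerivAt.comp e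
      (mdifferentiableAt_extChartAt_symm he).hasMFDerivAt))
  have h₂ := h₁.mfderiv
  rw [mfderiv_eq_fderiv] at h₂
  exact congrArg (fun T : E →L[ℝ] F => T v) h₂

theorem fderiv_localMap_self (x : M) (v : E) :
    fderiv ℝ (localMap E F π x) (extChartAt 𝓘(ℝ, E) x x) v = tangentAt E F π x v := by
  rw [fderiv_localMap hπ x (mem_extChartAt_target x)
    (by rw [extChartAt_to_inv]; exact mem_extChartAt_source (π x)), frame_self, extChartAt_to_inv,
    coframe_self]
  rfl

theorem differential_comp {u : B → ℝ} (hu : ContMDiff 𝓘(ℝ, F) 𝓘(ℝ, ℝ) 2 u) (x : M) (v : E) :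
    differential (u ∘ π) x v = differential u (π x) (tangentAt E F π x v) := by
  have h := mfderiv_comp x (hu.mdifferentiableAt two_ne_zero (x := π x))
    (hπ.mdifferentiableAt (by simp) (x := x))
  exact congrArg (fun T : E →L[ℝ] ℝ => T v) h

theorem comp_localMap_eventuallyEq (u : B → ℝ) (x : M) :
    (u ∘ π) ∘ (extChartAt 𝓘(ℝ, E) x).symm =ᶠ[𝓝 (extChartAt 𝓘(ℝ, E) x x)]
      (u ∘ (extChartAt 𝓘(ℝ, F) (π x)).symm) ∘ localMap E F π x := by
  filter_upwards [eventually_mem_source hπ x] with e he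
  simp only [Function.comp_apply, localMap, (extChartAt 𝓘(ℝ, F) (π x)).left_inv he.2]

end Smooth

variable (hgM : IsSemiRiemannianMetric gM) (hgB : IsSemiRiemannianMetric gB)
  (hπ : IsSemiRiemannianSubmersion gM gB π)

include hπ

theorem surjective_tangentAt (x : M) : Function.Surjective (tangentAt E F π x) := hπ.submersion x

theorem nondegenerate_restrict_ker (x : M) :
    ((metricAt gM x).restrict (LinearMap.ker (tangentAt E F π x).toLinearMap)).Nondegenerate :=
  hπ.fiber_nondegenerate x

include hgM

theorem metricAt_tangentAt (x : M) (X : E)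
    (hX : ∀ v, tangentAt E F π x v = 0 → metricAt gM x X v = 0)
    (w : E) : metricAt gB (π x) (tangentAt E F π x X) (tangentAt E F π x w) = metricAt gM x X w :=
  apply_horizontal (T := (tangentAt E F π x).toLinearMap) (γ' := metricAt gB (π x))
    (isSymm_metricAt hgM x) (surjective_tangentAt hπ x) (nondegenerate_restrict_ker hπ x)
    (fun X Y hX hY => hπ.isometry x X Y (fun V hV => hX V hV) (fun V hV => hY V hV)) hX w

theorem localMetric_localMap (x : M) : ∀ᶠ e in 𝓝 (extChartAt 𝓘(ℝ, E) x x), ∀ X,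
    (∀ V, fderiv ℝ (localMap E F π x) e V = 0 → localMetric gM x e X V = 0) →
      ∀ w, localMetric gB (π x) (localMap E F π x e) (fderiv ℝ (localMap E F π x) e X)
        (fderiv ℝ (localMap E F π x) e w) = localMetric gM x e X w := by
  filter_upwards [eventually_mem_source hπ.smooth x] with e he X hX w
  have hd := fderiv_localMap hπ.smooth x he.1 he.2
  have h₁ : (extChartAt 𝓘(ℝ, F) (π x)).symm (localMap E F π x e) =
      π ((extChartAt 𝓘(ℝ, E) x).symm e) := (extChartAt 𝓘(ℝ, F) (π x)).left_inv he.2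
  have h₂ : localMap E F π x e ∈ (extChartAt 𝓘(ℝ, F) (π x)).target :=
    (extChartAt 𝓘(ℝ, F) (π x)).map_source he.2
  have h₃ (v : E) : frame (π x) (localMap E F π x e) (fderiv ℝ (localMap E F π x) e v) =
      tangentAt E F π ((extChartAt 𝓘(ℝ, E) x).symm e) (frame x e v) := by
    rw [hd, ← h₁, frame_coframe h₂]
  rw [localMetric_apply, localMetric_apply, h₃, h₃, h₁]
  refine metricAt_tangentAt hgM hπ _ _ (fun v hv => ?_) _
  have h₄ := hX (coframe x ((extChartAt 𝓘(ℝ, E) x).symm e) v) (by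
    rw [hd, frame_coframe he.1, hv, map_zero])
  rwa [localMetric_apply, frame_coframe he.1] at h₄

variable {ε : ℝ} (hε : ε ≠ 0) {u : B → ℝ} (hu : ContMDiff 𝓘(ℝ, F) 𝓘(ℝ, ℝ) 2 u)
  {ν : (p : B) → TangentSpace (𝓘(ℝ, F).prod 𝓘(ℝ, ℝ)) (graphMap u p)}
  (hν : IsUnitUpwardNormal gB ε u ν)
  {ν' : (x : M) → TangentSpace (𝓘(ℝ, E).prod 𝓘(ℝ, ℝ)) (graphMap (u ∘ π) x)}
  (hν' : IsUnitUpwardNormal gM ε (u ∘ π) ν')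

omit hgM in
include hu in
theorem contMDiff_lift : ContMDiff 𝓘(ℝ, E) 𝓘(ℝ, ℝ) 2 (u ∘ π) :=
  hu.comp (hπ.smooth.of_le (WithTop.coe_le_coe.2 (le_top : (2 : ℕ∞) ≤ ⊤)))

omit hgM in
include hu hν' in
theorem normalAt_horizontal (x : M) (v : E) (hv : tangentAt E F π x v = 0) :
    metricAt gM x (normalAt ν' x).1 v = 0 := by
  have h := prodForm_normalAt (contMDiff_lift hπ hu) hν' x v
  rw [prodForm_apply] at h
  simp only [ContinuousLinearMap.coe_coe] at h
  rw [differential_comp hπ.smooth hu, hv, map_zero] at h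
  simpa using h

include hu hν hν'

theorem normalAt_lift (x : M) :
    tangentAt E F π x (normalAt ν' x).1 = (normalAt ν (π x)).1 ∧
      (normalAt ν' x).2 = (normalAt ν (π x)).2 := by
  refine normal_lift (T := (tangentAt E F π x).toLinearMap) (γ' := metricAt gB (π x))
    (nondegenerate_metricAt hgM x) (isSymm_metricAt hgM x) (surjective_tangentAt hπ x)
    (nondegenerate_restrict_ker hπ x) (metricAt_tangentAt hgM hπ x)
    (α := (differential u (π x)).toLinearMap) (fun v => ?_) (prodForm_normalAt hu hν (π x))
    (prodForm_normalAt_self hν' x) (prodForm_normalAt_self hν (π x)) (hν'.upward x)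
    (hν.upward (π x))
  have h := prodForm_normalAt (contMDiff_lift hπ hu) hν' x v
  simp only [ContinuousLinearMap.coe_coe] at h
  rwa [differential_comp hπ.smooth hu] at h

/-- The component tangent to `M` of the unit normal of the lifted graph is a basic vector field. -/
theorem isBasic_normalAt [IsManifold 𝓘(ℝ, E) 1 M] :
    IsBasic 𝓘(ℝ, F) gM π (fun x => (normalAt ν' x).1) where
  contMDiff := contMDiff_of_localField (n := 1) (by simp)
    (fun x => (contDiffAt_normalAt hgM (contMDiff_lift hπ hu) hν' x).2)
  horizontal := fun x V hV => normalAt_horizontal hπ hu hν' x V hV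
  projectable := ⟨fun p => (normalAt ν p).1, fun x => (normalAt_lift hgM hπ hu hν hν' x).1⟩

omit hν in
theorem fiberMeanCurvature_normalAt (x : M) :
    fiberMeanCurvature 𝓘(ℝ, F) gM π (fun x => (normalAt ν' x).1) x =
      -metricTrace ((metricAt gM x).restrict (LinearMap.ker (tangentAt E F π x).toLinearMap))
        (fun U V => hessianForm (localMetric gM x) ((u ∘ π) ∘ (extChartAt 𝓘(ℝ, E) x).symm)
          (extChartAt 𝓘(ℝ, E) x x) (normalAt ν' x).1 (ε * (normalAt ν' x).2) U V) := by
  have hd (V : LinearMap.ker (tangentAt E F π x).toLinearMap) :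
      differential (u ∘ π) x (V : E) = 0 := by
    have hV : tangentAt E F π x (V : E) = 0 := V.2
    rw [differential_comp hπ.smooth hu, hV, map_zero]
  rw [← metricTrace_neg]
  refine congrArg (metricTrace ((metricAt gM x).restrict
    (LinearMap.ker (tangentAt E F π x).toLinearMap))) (funext fun U => funext fun V => ?_)
  exact apply_covDeriv_normalAt hgM (contMDiff_lift hπ hu) hν' x U.1 (hd V)

include hε

omit hν in
/-- The mean curvature of the fibers of `π × 1` in the direction of the normal of the lifted graph
is that of the fibers of `π` in the direction of its component tangent to `M`. -/
theorem fiberMeanCurvature_prodMap (x : M) (t : ℝ) :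
    fiberMeanCurvature (𝓘(ℝ, F).prod 𝓘(ℝ, ℝ)) (prodMetric gM ε) (Prod.map π (id : ℝ → ℝ))
        (translationExtension ν') (x, t) =
      fiberMeanCurvature 𝓘(ℝ, F) gM π (fun x => (normalAt ν' x).1) x := by
  have hu' := contMDiff_lift hπ hu
  set S : Submodule ℝ (E × ℝ) := vertical (𝓘(ℝ, E).prod 𝓘(ℝ, ℝ)) (𝓘(ℝ, F).prod 𝓘(ℝ, ℝ))
    (Prod.map π (id : ℝ → ℝ)) ((x, t) : M × ℝ)
  have hS (z : E × ℝ) : z ∈ S ↔ tangentAt E F π x z.1 = 0 ∧ z.2 = 0 := by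
    have h := mfderiv_prodMap (p := ((x, t) : M × ℝ)) (f := π) (g := (id : ℝ → ℝ))
      (I := 𝓘(ℝ, E)) (I' := 𝓘(ℝ, ℝ)) (hπ.smooth.mdifferentiableAt (by simp)) mdifferentiableAt_id
    rw [mfderiv_id] at h
    have h' : (mfderiv (𝓘(ℝ, E).prod 𝓘(ℝ, ℝ)) (𝓘(ℝ, F).prod 𝓘(ℝ, ℝ)) (Prod.map π (id : ℝ → ℝ))
        ((x, t) : M × ℝ) z : F × ℝ) = (tangentAt E F π x z.1, z.2) :=
      congrArg (fun T : E × ℝ →L[ℝ] F × ℝ => T z) h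
    exact (Eq.congr_left h').trans Prod.mk_eq_zero
  set H := hessianForm (localMetric gM x) ((u ∘ π) ∘ (extChartAt 𝓘(ℝ, E) x).symm)
    (extChartAt 𝓘(ℝ, E) x x) (normalAt ν' x).1 (ε * (normalAt ν' x).2)
  have hcov (U V : E × ℝ) (hU : U ∈ S) (hV : V ∈ S) : prodForm (metricAt gM x) ε
      (covDeriv (prodMetric gM ε) (translationExtension ν') (x, t) U) V = -H U.1 V.1 := by
    obtain ⟨h₁, h₂⟩ := contDiffAt_normalAt hgM hu' hν' x
    obtain ⟨U, r⟩ := U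
    obtain ⟨V, r'⟩ := V
    obtain ⟨hU₁, hU₂⟩ := (hS _).1 hU
    obtain ⟨hV₁, hV₂⟩ := (hS _).1 hV
    simp only at hU₁ hU₂ hV₁ hV₂
    subst hU₂ hV₂
    refine (apply_covDeriv_prodMetric hgM hε (Z := normalAt ν') x t
      (h₂.differentiableAt one_ne_zero) (h₁.differentiableAt one_ne_zero) U V).trans ?_
    exact apply_covDeriv_normalAt hgM hu' hν' x U
      (by rw [differential_comp hπ.smooth hu, hV₁, map_zero])
  have h₁ : fiberMeanCurvature (𝓘(ℝ, F).prod 𝓘(ℝ, ℝ)) (prodMetric gM ε)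
      (Prod.map π (id : ℝ → ℝ)) (translationExtension ν') (x, t) =
      metricTrace ((prodForm (metricAt gM x) ε).restrict S) (fun U V => -H U.1.1 V.1.1) :=
    congrArg (metricTrace ((prodForm (metricAt gM x) ε).restrict S))
      (funext fun U => funext fun V => hcov U.1 V.1 U.2 V.2)
  rw [h₁, metricTrace_neg, metricTrace_restrict_prod (T := (tangentAt E F π x).toLinearMap) hS
    (nondegenerate_restrict_ker hπ x), fiberMeanCurvature_normalAt hgM hπ hu hν']

include hgB

/-- The mean curvature of the lifted graph is the lift of the mean curvature of the graph minus the
mean curvature of the fibers. -/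
theorem graphMeanCurvature_lift (x : M) :
    graphMeanCurvature gM ε (u ∘ π) ν' x = graphMeanCurvature gB ε u ν (π x) -
      fiberMeanCurvature 𝓘(ℝ, F) gM π (fun x => (normalAt ν' x).1) x := by
  have hx := mem_extChartAt_target (I := 𝓘(ℝ, E)) x
  have hp := mem_extChartAt_target (I := 𝓘(ℝ, F)) (π x)
  obtain ⟨hl₁, hl₂⟩ := normalAt_lift hgM hπ hu hν hν' x
  have hα : (differential (u ∘ π) x).toLinearMap =
      (differential u (π x)).toLinearMap.comp (tangentAt E F π x).toLinearMap :=
    LinearMap.ext fun v => differential_comp hπ.smooth hu x v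
  have hhor (X : E) (hX : ∀ v, tangentAt E F π x v = 0 → metricAt gM x X v = 0) (V : E)
      (hV : fderiv ℝ (localMap E F π x) (extChartAt 𝓘(ℝ, E) x x) V = 0) :
      localMetric gM x (extChartAt 𝓘(ℝ, E) x x) X V = 0 := by
    rw [localMetric_self]
    rw [fderiv_localMap_self hπ.smooth] at hV
    exact hX V hV
  have hP := localMap_self (E := E) (F := F) π x
  have h := metricTrace_graphForm_lift (T := (tangentAt E F π x).toLinearMap)
    (γ' := metricAt gB (π x)) (ε := ε) (α := (differential u (π x)).toLinearMap)
    (isSymm_metricAt hgM x) (surjective_tangentAt hπ x) (nondegenerate_restrict_ker hπ x)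
    (metricAt_tangentAt hgM hπ x) (nondegenerate_graphForm_differential hgB hu hν (π x))
    (b := hessianForm (localMetric gM x) ((u ∘ π) ∘ (extChartAt 𝓘(ℝ, E) x).symm)
      (extChartAt 𝓘(ℝ, E) x x) (normalAt ν' x).1 (ε * (normalAt ν' x).2))
    (b' := hessianForm (localMetric gB (π x)) (u ∘ (extChartAt 𝓘(ℝ, F) (π x)).symm)
      (extChartAt 𝓘(ℝ, F) (π x) (π x)) (normalAt ν (π x)).1 (ε * (normalAt ν (π x)).2))
    (fun X Y hX hY => by
      have h := hessianForm_comp_horizontal (K := localMetric gB (π x))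
        (contDiffAt_localMetric hgM x hx (n := 1))
        (by rw [hP]; exact contDiffAt_localMetric hgB (π x) hp (n := 1))
        (contDiffAt_localMap hπ.smooth x) (localMetric_injective hgM x hx)
        (localMetric_symm hgM x _) (localMetric_symm hgB (π x) _) (localMetric_localMap hgM hπ x)
        (u := u ∘ (extChartAt 𝓘(ℝ, F) (π x)).symm)
        (by rw [hP]; exact contDiffAt_comp_extChartAt_symm hu (π x) hp)
        (c := ε * (normalAt ν' x).2) (hhor X hX) (hhor Y hY)
        (hhor (normalAt ν' x).1 (normalAt_horizontal hπ hu hν' x))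
        (fun w => by
          rw [fderiv_localMap_self hπ.smooth, hP, localMetric_self, hl₁, hl₂,
            ← differential_eq_fderiv hu]
          have := prodForm_normalAt hu hν (π x) w
          rw [prodForm_apply] at this
          simp only [ContinuousLinearMap.coe_coe] at this
          linarith)
      rw [hessianForm_congr (comp_localMap_eventuallyEq hπ.smooth u x), h, hP,
        fderiv_localMap_self hπ.smooth, fderiv_localMap_self hπ.smooth,
        fderiv_localMap_self hπ.smooth, hl₁, hl₂]
      rfl)
  rw [graphMeanCurvature, graphMeanCurvature, hα, h, fiberMeanCurvature_normalAt hgM hπ hu hν']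
  ring

end Submersion

end TransSoliton

theorem mainTheorem2
    {EM : Type*} [NormedAddCommGroup EM] [NormedSpace ℝ EM] [FiniteDimensional ℝ EM]
    {M : Type*} [TopologicalSpace M] [T2Space M] [ChartedSpace EM M] [IsManifold 𝓘(ℝ, EM) ∞ M]
    {EB : Type*} [NormedAddCommGroup EB] [NormedSpace ℝ EB] [FiniteDimensional ℝ EB]
    {B : Type*} [TopologicalSpace B] [T2Space B] [ChartedSpace EB B] [IsManifold 𝓘(ℝ, EB) ∞ B]
    (gM : TransSoliton.BilinField 𝓘(ℝ, EM) M) (hgM : TransSoliton.IsSemiRiemannianMetric gM)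
    (gB : TransSoliton.BilinField 𝓘(ℝ, EB) B) (hgB : TransSoliton.IsSemiRiemannianMetric gB)
    (ε : ℝ) (hε : ε = 1 ∨ ε = -1)
    (π : M → B) (hπ : TransSoliton.IsSemiRiemannianSubmersion gM gB π)
    (hcmc : TransSoliton.HasCMCFibers 𝓘(ℝ, EB) gM π)
    (u : B → ℝ) (hu : ContMDiff 𝓘(ℝ, EB) 𝓘(ℝ, ℝ) 2 u)
    (νF : (p : B) → TangentSpace (𝓘(ℝ, EB).prod 𝓘(ℝ, ℝ)) (TransSoliton.graphMap u p))
    (hνF : TransSoliton.IsUnitUpwardNormal gB ε u νF)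
    (νF' : (x : M) → TangentSpace (𝓘(ℝ, EM).prod 𝓘(ℝ, ℝ)) (TransSoliton.graphMap (u ∘ π) x))
    (hνF' : TransSoliton.IsUnitUpwardNormal gM ε (u ∘ π) νF') :
    ∃ Hfib : B → ℝ,
      (∀ (x : M) (t : ℝ), TransSoliton.fiberMeanCurvature (𝓘(ℝ, EB).prod 𝓘(ℝ, ℝ))
        (TransSoliton.prodMetric gM ε) (Prod.map π (id : ℝ → ℝ))
        (TransSoliton.translationExtension νF') (x, t) = Hfib (π x)) ∧
      (TransSoliton.IsGraphicalTranslatingSoliton gM ε (u ∘ π) ↔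
        ∀ p : B,
          TransSoliton.meanCurvatureVector 𝓘(ℝ, EB) (TransSoliton.prodMetric gB ε)
              (TransSoliton.graphMap u) p =
            TransSoliton.partialTPerp gB ε u p +
              (TransSoliton.prodMetric gB ε (TransSoliton.graphMap u p) (νF p) (νF p) *
                Hfib p) • νF p) := by
  have hε₀ : ε ≠ 0 := by rcases hε with h | h <;> rw [h] <;> norm_num
  have hu' := TransSoliton.contMDiff_lift hπ hu
  -- The mean curvature of the fibers is constant along them, so any point of a fiber may be used.
  set Hfib : B → ℝ := fun p => TransSoliton.fiberMeanCurvature 𝓘(ℝ, EB) gM π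
    (fun x => (TransSoliton.normalAt νF' x).1) (Function.surjInv hπ.surjective p) with hHfib
  have hH (x : M) : TransSoliton.fiberMeanCurvature 𝓘(ℝ, EB) gM π
      (fun x => (TransSoliton.normalAt νF' x).1) x = Hfib (π x) :=
    hcmc _ (TransSoliton.isBasic_normalAt hgM hπ hu hνF hνF') _ _
      (Function.surjInv_eq hπ.surjective (π x)).symm
  refine ⟨Hfib, fun x t => ?_, ?_⟩
  · rw [TransSoliton.fiberMeanCurvature_prodMap hgM hπ hε₀ hu hνF', hH]
  -- Both sides of either vector equation are multiples of the normal, which leaves a scalar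
  -- equation.
  have hM (x : M) : TransSoliton.meanCurvatureVector 𝓘(ℝ, EM) (TransSoliton.prodMetric gM ε)
        (TransSoliton.graphMap (u ∘ π)) x = TransSoliton.partialTPerp gM ε (u ∘ π) x ↔
      TransSoliton.graphMeanCurvature gM ε (u ∘ π) νF' x = ε * (TransSoliton.normalAt νF' x).2 := by
    refine (Eq.congr (TransSoliton.meanCurvatureVector_eq hgM hε₀ hu' hνF' x)
      (TransSoliton.partialTPerp_eq hgM hu' hνF' x)).trans ?_
    exact TransSoliton.smul_normalAt_inj hνF' x _ _
  have hB (p : B) : TransSoliton.meanCurvatureVector 𝓘(ℝ, EB) (TransSoliton.prodMetric gB ε)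
        (TransSoliton.graphMap u) p = TransSoliton.partialTPerp gB ε u p +
          (TransSoliton.prodMetric gB ε (TransSoliton.graphMap u p) (νF p) (νF p) *
            Hfib p) • νF p ↔
      TransSoliton.graphMeanCurvature gB ε u νF p =
        ε * (TransSoliton.normalAt νF p).2 + Hfib p := by
    refine (Eq.congr (TransSoliton.meanCurvatureVector_eq hgB hε₀ hu hνF p)
      ((congrArg (fun z : EB × ℝ => z + (TransSoliton.prodForm (TransSoliton.metricAt gB p) ε
        (TransSoliton.normalAt νF p) (TransSoliton.normalAt νF p) * Hfib p) •
          TransSoliton.normalAt νF p) (TransSoliton.partialTPerp_eq hgB hu hνF p)).trans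
        ((add_smul _ _ _).symm.trans (congrArg (· • TransSoliton.normalAt νF p)
          (mul_add _ _ _).symm)))).trans ?_
    exact TransSoliton.smul_normalAt_inj hνF p _ _
  have hMB (x : M) : TransSoliton.graphMeanCurvature gM ε (u ∘ π) νF' x =
        ε * (TransSoliton.normalAt νF' x).2 ↔
      TransSoliton.graphMeanCurvature gB ε u νF (π x) =
        ε * (TransSoliton.normalAt νF (π x)).2 + Hfib (π x) := by
    rw [TransSoliton.graphMeanCurvature_lift hgM hgB hπ hε₀ hu hνF hνF', hH,
      (TransSoliton.normalAt_lift hgM hπ hu hνF hνF' x).2]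
    exact sub_eq_iff_eq_add
  constructor
  · intro h p
    obtain ⟨x, rfl⟩ := hπ.surjective p
    exact (hB _).2 ((hMB x).1 ((hM x).1 (h.equation x)))
  · intro h
    refine ⟨hu', fun x => ?_, fun x => (hM x).2 ((hMB x).2 ((hB _).1 (h (π x))))⟩
    exact (TransSoliton.inducedMetric_graphMap hu' gM ε x).symm ▸
      TransSoliton.nondegenerate_graphForm_differential hgM hu' hνF' x
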